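/- **Theorem (Slow rates for total variation image denoising).** *Setting.* Let $n_1\ge 1$ and $n=n_1^2$. For an image $f\in\mathbb R^{n_1\times n_1}$ let $\|f\|_2$ be the Frobenius norm, let $(\Delta f)_{j,k}=f_{j,k}-f_{j,k-1}-f_{j-1,k}+f_{j-1,k-1}$ for $(j,k)\in I:=\{2,\dots,n_1\}^2$, let $\mathrm{TV}(f)=\sum_{(j,k)\in I}|(\Delta f)_{j,k}|$, and let $\tilde f_{j,k}=f_{j,k}-\frac1{n_1}\sum_{k'}f_{j,k'}-\frac1{n_1}\sum_{j'}f_{j',k}+\frac1n\sum_{j',k'}f_{j',k'}$ be its interaction terms. We observe $Y=f^0+\epsilon$, where the entries of $\epsilon$ are i.i.d. $N(0,\sigma^2)$, $\sigma>0$, and $\mathrm{TV}(\tilde f^0)\le C$ with $C>0$. For $\lambda>0$ let $$\hat{\tilde f}=\operatorname*{arg\,min}_{\mathrm f\in\mathbb R^{n_1\times n_1}}\bigl\{\|\tilde Y-\mathrm f\|_2^2/n+2\lambda\,\mathrm{TV}(\mathrm f)\bigr\}.$$ *Active set.* Let $t\ge1$ be an even integer such that $d:=n_1/(t^2+1)$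 is an integer. Let $M=\{1+md: m=1,\dots,t^2\}$, $N=\{1+(\tfrac t2+ti)d: i=0,\dots,t-1\}$, let $S_M=(M\times N)\cup(N\times M)\subseteq I$ be the mesh grid, and put $s_M=2t^3$ (the number $2t^3-t^2$ of points of $S_M$, increased by $t^2$ by convention). For $(j,k)\in I$ let $\psi^{j,k}_{j',k'}=1_{\{j'\ge j,\,k'\ge k\}}$ and let $\tilde\psi^{j,k}$ be its interaction terms. A matrix $\tilde v\in\mathbb R^{I}$ is a bound on the antiprojections for $S_M$ if, for every $(j,k)\in I$, $\tilde v_{j,k}\ge\|\mathrm A\,\tilde\psi^{j,k}\|_2/\sqrt n$, where $\mathrm A$ is the orthogonal projection onto the orthogonal complement of $\mathrm{span}\{\tilde\psi^{j,k}:(j,k)\in S_M\}$; the corresponding inverse scaling factor is $\tilde\gamma=\max_{(j,k)\in I\setminus S_M}|\tilde v_{j,k}|$ (and $0$ if $I\setminus S_M=\emptyset$). Let $\lambda_0(x)=\sigma\sqrt{(2\log(2n)+2x)/n}$. *(i) Dependence of $S_M$ and $\lambda$ on $f^0$ allowed.* Suppose that $\mathrm{TV}(f^0)>0$, let $$X=\frac{2^{5/4}3^{3/4}\log^{3/8}(2n)\,n^{3/8}\,\mathrm{TV}^{3/4}(f^0)}{\sigma^{3/4}},\qquad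 \lambda=\frac{3^{3/4}\sigma^{5/4}\log^{3/8}(2n)}{2^{1/12}n^{5/8}\,\mathrm{TV}^{1/4}(f^0)},$$ and let $t$ be such that $\lceil X\rceil\le s_M\le\frac75X+1$ (for instance $s_M=\lceil X\rceil$). Then the constant matrix $\tilde v\equiv\frac{3}{2t}$ is a bound on the antiprojections for $S_M$, the corresponding $\tilde\gamma$ satisfies $\lambda\ge\tilde\gamma\lambda_0(\log(2n))$, and with probability at least $1-1/n$ $$\|\hat{\tilde f}-\tilde f^0\|_2^2/n\le\frac{24\,\sigma^{5/4}C^{3/4}\log^{3/8}(2n)}{n^{5/8}}+\frac{4\sigma^2\log(2n)}{n}+\frac{2\sigma^2}{n}.$$ *(ii) Dependence of $S_M$ and $\lambda$ on $f^0$ not allowed.* Let $$X=2^{5/4}3^{3/4}\log^{3/8}(2n)\,n^{3/8},\qquad \lambda=\frac{3^{3/4}\sigma\log^{3/8}(2n)}{2^{1/12}n^{5/8}},$$ and let $t$ be such that $\lceil X\rceil\le s_M\le\frac{11}{10}X+1$ (for instance $s_M=\lceil X\rceil$). Then the constant matrix $\tilde v\equiv\frac{3}{2t}$ is a bound on the antiprojections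 for $S_M$, the corresponding $\tilde\gamma$ satisfies $\lambda\ge\tilde\gamma\lambda_0(\log(2n))$, and with probability at least $1-1/n$ $$\|\hat{\tilde f}-\tilde f^0\|_2^2/n\le\frac{12\,\sigma(C+\sigma)\log^{3/8}(2n)}{n^{5/8}}+\frac{4\sigma^2\log(2n)}{n}+\frac{2\sigma^2}{n}.$$ -/

import Mathlib

open MeasureTheory ProbabilityTheory

noncomputable section

namespace TVDenoise

/-- Images with `n₁ × n₂` pixels. The norm of this space is the Frobenius norm. The entry of `f`
in row `j` and column `k` is `f (j, k)`; rows and columns are numbered from `0`. -/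
abbrev Image (n₁ n₂ : ℕ) : Type := EuclideanSpace ℝ (Fin n₁ × Fin n₂)

/-- Index set of the entries of the discrete derivative of an image: the index `(a, b)` stands for
the pixel in row `a + 1` and column `b + 1` when rows and columns are numbered from `0`, that is,
for the pixel `(a + 2, b + 2)` of `[2 : n₁] × [2 : n₂]` when they are numbered from `1`. -/
abbrev DIdx (n₁ n₂ : ℕ) : Type := Fin (n₁ - 1) × Fin (n₂ - 1)

variable {n₁ n₂ : ℕ}

/-- The two-dimensional discrete derivative (total derivative) `Δ f`. -/
def delta (f : Image n₁ n₂) (p : DIdx n₁ n₂) : ℝ :=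
  f (⟨p.1 + 1, by omega⟩, ⟨p.2 + 1, by omega⟩) - f (⟨p.1 + 1, by omega⟩, ⟨p.2, by omega⟩)
    - f (⟨p.1, by omega⟩, ⟨p.2 + 1, by omega⟩) + f (⟨p.1, by omega⟩, ⟨p.2, by omega⟩)

/-- The total variation `TV f = ‖Δ f‖₁`. -/
def TV (f : Image n₁ n₂) : ℝ := ∑ p : DIdx n₁ n₂, |delta f p|

/-- The global mean `f(∘,∘)`. -/
def globalMean (f : Image n₁ n₂) : ℝ := (∑ j, ∑ k, f (j, k)) / ((n₁ : ℝ) * n₂)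

/-- The row main effects `f(j,∘)`. -/
def rowEffect (f : Image n₁ n₂) (j : Fin n₁) : ℝ := (∑ k, f (j, k)) / n₂ - globalMean f

/-- The column main effects `f(∘,k)`. -/
def colEffect (f : Image n₁ n₂) (k : Fin n₂) : ℝ := (∑ j, f (j, k)) / n₁ - globalMean f

/-- The interaction terms of an image. -/
def interaction (f : Image n₁ n₂) : Image n₁ n₂ :=
  WithLp.toLp 2 fun q => f q - globalMean f - rowEffect f q.1 - colEffect f q.2

/-- The penalized least squares criterion `‖y - f‖² / n + 2 λ TV f`, with `n = n₁ n₂`. -/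
def objective (lam : ℝ) (y f : Image n₁ n₂) : ℝ :=
  ‖y - f‖ ^ 2 / ((n₁ : ℝ) * n₂) + 2 * lam * TV f

/-- The estimator of the interaction terms with tuning parameter `lam` based on the observed
image `Y`: the minimizer of the criterion at the interaction terms of `Y`. For `0 ≤ lam` and a
non-empty image the minimizer exists and is unique, see `interactionEstimator_spec` and
`eq_interactionEstimator`. -/
def interactionEstimator (lam : ℝ) (Y : Image n₁ n₂) : Image n₁ n₂ :=
  Classical.epsilon fun fhat => ∀ f, objective lam (interaction Y) fhat ≤
    objective lam (interaction Y) f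

/-- The class `𝓕(C)` of images of total variation at most `C`. -/
def tvClass (n₁ n₂ : ℕ) (C : ℝ) : Set (Image n₁ n₂) := {f | TV f ≤ C}

/-- The dictionary atom `ψ^{j,k}`, the indicator of the half-intervals starting at the pixel
`(j, k)` that the index `p` stands for. -/
def atom (p : DIdx n₁ n₂) : Image n₁ n₂ :=
  WithLp.toLp 2 fun q => if p.1.val + 1 ≤ q.1.val ∧ p.2.val + 1 ≤ q.2.val then 1 else 0

/-- The atoms of the synthesis form of the estimator: the interaction terms of the `ψ^{j,k}`. -/
def tildeAtom (p : DIdx n₁ n₂) : Image n₁ n₂ := interaction (atom p)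

/-- The span of the atoms with index in the active set `S`. -/
def activeSpan (S : Set (DIdx n₁ n₂)) : Submodule ℝ (Image n₁ n₂) :=
  Submodule.span ℝ (tildeAtom '' S)

/-- `v` is a bound on the antiprojections for the active set `S`: it dominates the norms, divided
by `√n`, of the residuals of the orthogonal projections of the atoms on the active span. -/
def IsAntiprojectionBound (S : Set (DIdx n₁ n₂)) (v : DIdx n₁ n₂ → ℝ) : Prop :=
  ∀ p, ‖tildeAtom p - (activeSpan S).starProjection (tildeAtom p)‖ / √((n₁ : ℝ) * n₂) ≤ v p

/-- The inverse scaling factor `‖v_{-S}‖_∞` (the norm on the function space is the maximum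
norm). -/
def inverseScaling (S : Set (DIdx n₁ n₂)) (v : DIdx n₁ n₂ → ℝ) : ℝ := ‖Sᶜ.indicator v‖

/-- The universal choice `λ₀(x)` of the tuning parameter for images with `n` pixels and noise
standard deviation `σ`. -/
def lambda0 (σ n x : ℝ) : ℝ := σ * √((2 * Real.log (2 * n) + 2 * x) / n)

/-- The coordinates `m N / (t² + 1)`, `m = 1, …, t²` (numbered from `0`; numbered from `1`, they
are `1 + m N / (t² + 1)`) of the fine one-dimensional mesh. -/
def meshFine (N t : ℕ) : Set ℕ := {c | ∃ m, 1 ≤ m ∧ m ≤ t ^ 2 ∧ c = m * (N / (t ^ 2 + 1))}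

/-- The coordinates `(⌈t/2⌉ + t i) N / (t² + 1)`, `i = 0, …, t - 1` (numbered from `0`) of the
coarse one-dimensional mesh. -/
def meshCoarse (N t : ℕ) : Set ℕ := {c | ∃ i < t, c = ((t + 1) / 2 + t * i) * (N / (t ^ 2 + 1))}

/-- The mesh grid `S_M = M₁ × N₂ ∪ N₁ × M₂` with parameters `t₁, t₂`. It is used when `t₁² + 1`
divides `n₁` and `t₂² + 1` divides `n₂`. -/
def meshGrid (n₁ n₂ t₁ t₂ : ℕ) : Set (DIdx n₁ n₂) :=
  {p | (p.1.val + 1 ∈ meshFine n₁ t₁ ∧ p.2.val + 1 ∈ meshCoarse n₂ t₂) ∨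
    (p.1.val + 1 ∈ meshCoarse n₁ t₁ ∧ p.2.val + 1 ∈ meshFine n₂ t₂)}

/-- The size `s_M = t₁ t₂ (t₁ + t₂)` attributed to the mesh grid (which has `t₁ t₂ (t₁ + t₂ - 1)`
points). -/
def meshSize (t₁ t₂ : ℕ) : ℕ := t₁ * t₂ * (t₁ + t₂)

/-! ### The estimator is well defined -/

theorem continuous_TV : Continuous (TV : Image n₁ n₂ → ℝ) := by
  unfold TV delta
  fun_prop

theorem TV_nonneg (f : Image n₁ n₂) : 0 ≤ TV f := Finset.sum_nonneg fun _ _ => abs_nonneg _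

theorem delta_midpoint (f g : Image n₁ n₂) (p : DIdx n₁ n₂) :
    delta ((1 / 2 : ℝ) • (f + g)) p = (delta f p + delta g p) / 2 := by
  simp [delta]
  ring

theorem TV_midpoint_le (f g : Image n₁ n₂) :
    TV ((1 / 2 : ℝ) • (f + g)) ≤ (TV f + TV g) / 2 := by
  unfold TV
  rw [← Finset.sum_add_distrib, Finset.sum_div]
  refine Finset.sum_le_sum fun p _ => ?_
  rw [delta_midpoint, abs_div, abs_two]
  have := abs_add_le (delta f p) (delta g p)
  linarith

theorem exists_minimizer (h₁ : 0 < n₁) (h₂ : 0 < n₂) {lam : ℝ} (hlam : 0 ≤ lam)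
    (y : Image n₁ n₂) : ∃ fhat, ∀ f, objective lam y fhat ≤ objective lam y f := by
  have hn : (0 : ℝ) < (n₁ : ℝ) * n₂ := by positivity
  have hc : Continuous (objective lam y) := by
    have := continuous_TV (n₁ := n₁) (n₂ := n₂)
    unfold objective
    fun_prop
  refine hc.exists_forall_le ?_
  have h1 : Filter.Tendsto (fun f : Image n₁ n₂ => ‖y - f‖) (Filter.cocompact _) Filter.atTop :=
    by
    refine Filter.tendsto_atTop_mono (f := fun f => ‖f‖ + -‖y‖) (fun f => ?_)
      (Filter.tendsto_atTop_add_const_right _ _ tendsto_norm_cocompact_atTop)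
    have := norm_sub_norm_le f y
    rw [norm_sub_rev] at this
    linarith
  have h2 := ((Filter.tendsto_pow_atTop (α := ℝ) two_ne_zero).comp h1).atTop_div_const hn
  refine Filter.tendsto_atTop_mono (fun f => ?_) h2
  have : 0 ≤ 2 * lam * TV f := by have := TV_nonneg f; positivity
  simp only [objective, Function.comp]
  linarith

theorem minimizer_unique (h₁ : 0 < n₁) (h₂ : 0 < n₂) {lam : ℝ} (hlam : 0 ≤ lam)
    {y f g : Image n₁ n₂} (hf : ∀ h, objective lam y f ≤ objective lam y h)
    (hg : ∀ h, objective lam y g ≤ objective lam y h) : f = g := by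
  have hn : (0 : ℝ) < (n₁ : ℝ) * n₂ := by positivity
  set m : Image n₁ n₂ := (1 / 2 : ℝ) • (f + g)
  have hpar := parallelogram_law_with_norm ℝ (y - f) (y - g)
  have e1 : y - f + (y - g) = (2 : ℝ) • (y - m) := by
    simp only [m]; module
  rw [e1, norm_smul, show y - f - (y - g) = g - f by abel] at hpar
  have hT := mul_le_mul_of_nonneg_left (TV_midpoint_le f g) hlam
  have a := hf m
  have b := hg m
  have key : ‖y - f‖ ^ 2 + ‖y - g‖ ^ 2 ≤ 2 * ‖y - m‖ ^ 2 := by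
    simp only [objective] at a b
    have : (‖y - f‖ ^ 2 + ‖y - g‖ ^ 2) / ((n₁ : ℝ) * n₂)
        ≤ (2 * ‖y - m‖ ^ 2) / ((n₁ : ℝ) * n₂) := by
      rw [add_div, mul_div_assoc]
      simp only [m] at a b ⊢
      linarith
    exact (div_le_div_iff_of_pos_right hn).1 this
  have h0 : ‖g - f‖ = 0 := by
    norm_num at hpar
    nlinarith [norm_nonneg (g - f)]
  exact (sub_eq_zero.1 (norm_eq_zero.1 h0)).symm

theorem interactionEstimator_spec (h₁ : 0 < n₁) (h₂ : 0 < n₂) {lam : ℝ} (hlam : 0 ≤ lam)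
    (Y f : Image n₁ n₂) :
    objective lam (interaction Y) (interactionEstimator lam Y)
      ≤ objective lam (interaction Y) f :=
  Classical.epsilon_spec (exists_minimizer h₁ h₂ hlam (interaction Y)) f

theorem eq_interactionEstimator (h₁ : 0 < n₁) (h₂ : 0 < n₂) {lam : ℝ} (hlam : 0 ≤ lam)
    {Y fhat : Image n₁ n₂}
    (h : ∀ f, objective lam (interaction Y) fhat ≤ objective lam (interaction Y) f) :
    fhat = interactionEstimator lam Y :=
  minimizer_unique h₁ h₂ hlam h (interactionEstimator_spec h₁ h₂ hlam Y)

end TVDenoise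

end

/-! The error `δ` (estimator minus truth) is controlled by a variational inequality for the convex
criterion: ‖δ‖² is at most the pairing of the noise with the interaction terms of `δ`, plus
nλ(TV(f⁰) − TV(f̂)). By `interaction_eq_sum`, those interaction terms are a combination of the atoms
with coefficients Δδ. Splitting each atom into its projection onto the active span and its residual
splits the pairing. The projected part costs ‖Pε‖‖δ‖. The residual part costs at most nλ TV(δ) as
soon as nλ dominates the noise on every residual. Since TV(δ) ≤ TV(f̂) + TV(f⁰), the terms in TV(f̂)
cancel and ‖δ‖² ≤ ‖Pε‖² + 4nλ TV(f⁰) remains (`norm_interactionEstimator_sub_sq_le`). Gaussian tails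
bound ‖Pε‖² by σ²(2s + 4 log(2n)) and make λ ≥ ṽ λ₀(log(2n)) sufficient, with total failure
probability 1/n (`one_sub_inv_le_measureReal_mse_le`).

The geometric point is `isAntiprojectionBound_meshGrid`. Atoms are outer products of centered step
vectors, and a mixed product of fine and coarse one-dimensional approximations makes the residual of
order 1/t with only about 2t³ active atoms; a full product grid of mesh n₁/t² would need about t⁴.

What remains is a trade-off between λV of order σ√(log(2n)/n) V/t and σ²s/n of order σ²t³/n. The
prescribed X and λ balance them up to constants, λ being exactly (3/(2t)) λ₀(log(2n)) when 2t³ = X.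
Replacing V by σ in both gives the choice that ignores the image. -/

noncomputable section

namespace TVDenoise

/-! ### Gaussian tail bounds -/

section Gaussian

open scoped RealInnerProductSpace NNReal

variable {E : Type*} [NormedAddCommGroup E] [InnerProductSpace ℝ E] [FiniteDimensional ℝ E]
  [MeasurableSpace E] [BorelSpace E]

theorem map_inner_stdGaussian (w : E) :
    (stdGaussian E).map (fun z => ⟪w, z⟫) = gaussianReal 0 (‖w‖ ^ 2).toNNReal := by
  have h := IsGaussian.map_eq_gaussianReal (μ := stdGaussian E) (innerSL ℝ w)
  rw [integral_strongDual_stdGaussian, variance_dual_stdGaussian, innerSL_apply_norm] at h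
  exact h

theorem hasSubgaussianMGF_inner_stdGaussian {w : E} {c : ℝ≥0} (hw : ‖w‖ ^ 2 ≤ c) :
    HasSubgaussianMGF (fun z => ⟪w, z⟫) c (stdGaussian E) := by
  have hm : AEMeasurable (fun z => ⟪w, z⟫) (stdGaussian E) := by fun_prop
  rw [← HasSubgaussianMGF.id_map_iff hm, map_inner_stdGaussian]
  refine ⟨fun t => integrable_exp_mul_gaussianReal t, fun t => ?_⟩
  rw [mgf_id_gaussianReal]
  simp only [zero_mul, zero_add, Real.coe_toNNReal _ (sq_nonneg ‖w‖)]
  gcongr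

/-- Chernoff's bound for `w` and `-w`. Asking only ‖w‖ ≤ c allows degenerate directions, such as the
vanishing residuals of active atoms. -/
theorem stdGaussian_abs_inner_ge_le {w : E} {c y : ℝ} (hc : 0 < c) (hy : 0 ≤ y) (hw : ‖w‖ ≤ c) :
    (stdGaussian E).real {z | c * √(2 * y) ≤ |⟪w, z⟫|} ≤ 2 * Real.exp (-y) := by
  have key : ∀ v : E, ‖v‖ ≤ c →
      (stdGaussian E).real {z | c * √(2 * y) ≤ ⟪v, z⟫} ≤ Real.exp (-y) := by
    intro v hv
    have h2 : ‖v‖ ^ 2 ≤ ((c ^ 2).toNNReal : ℝ) := by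
      rw [Real.coe_toNNReal _ (sq_nonneg c)]
      gcongr
    refine ((hasSubgaussianMGF_inner_stdGaussian h2).measure_ge_le (by positivity)).trans_eq ?_
    rw [Real.coe_toNNReal _ (sq_nonneg c), mul_pow, Real.sq_sqrt (by positivity)]
    congr 1
    field_simp
  have hsub : {z : E | c * √(2 * y) ≤ |⟪w, z⟫|} ⊆
      {z | c * √(2 * y) ≤ ⟪w, z⟫} ∪ {z | c * √(2 * y) ≤ ⟪-w, z⟫} := by
    intro z hz
    simpa [le_abs] using hz
  have h1 := key w hw
  have h2 := key (-w) (by rwa [norm_neg])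
  have h3 := (measureReal_mono (μ := stdGaussian E) hsub).trans (measureReal_union_le _ _)
  linarith

theorem map_orthogonalProjection_stdGaussian (K : Submodule ℝ E) :
    (stdGaussian E).map K.orthogonalProjectionOnto = stdGaussian K := by
  refine Measure.ext_of_charFun ?_
  ext s
  -- For `s` in `K`, pairing `s` with a projection equals pairing it with the vector itself, so both
  -- characteristic functions at `s` agree.
  rw [charFun_apply, integral_map (by fun_prop) (by fun_prop)]
  have := charFun_stdGaussian (E := E) (s : E)
  rw [charFun_apply] at this
  rw [charFun_stdGaussian]
  simpa [Submodule.inner_orthogonalProjectionOnto_eq_of_mem_left] using this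

theorem integrable_exp_sq_gaussianReal :
    Integrable (fun x => Real.exp (1 / 4 * x ^ 2)) (gaussianReal 0 1) ∧
    ∫ x, Real.exp (1 / 4 * x ^ 2) ∂(gaussianReal 0 1) = √2 := by
  have e : ∀ x : ℝ, gaussianPDFReal 0 1 x * Real.exp (1 / 4 * x ^ 2) =
      (√(2 * Real.pi))⁻¹ * Real.exp (-(1 / 4) * x ^ 2) := by
    intro x
    simp only [gaussianPDFReal, NNReal.coe_one, mul_one, sub_zero]
    rw [mul_assoc, ← Real.exp_add]
    congr 2
    ring
  constructor
  · rw [gaussianReal_of_var_ne_zero _ one_ne_zero,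
      integrable_withDensity_iff_integrable_smul₀' (by fun_prop) (by simp [gaussianPDF])]
    simp only [toReal_gaussianPDF, smul_eq_mul, e]
    exact (integrable_exp_neg_mul_sq (by norm_num)).const_mul _
  · rw [integral_gaussianReal_eq_integral_smul one_ne_zero]
    simp only [smul_eq_mul, e]
    rw [integral_const_mul, integral_gaussian, ← Real.sqrt_inv, ← Real.sqrt_mul (by positivity)]
    congr 1
    field_simp
    norm_num

/-- Chernoff at exponent 1/4: in dimension k, ‖z‖² has moment generating function 2^(k/2) there, and
the factor exp(−k/2) coming from the threshold 2k absorbs it because 2 ≤ e. -/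
theorem stdGaussian_norm_sq_ge_le (E : Type*) [NormedAddCommGroup E] [InnerProductSpace ℝ E]
    [FiniteDimensional ℝ E] [MeasurableSpace E] [BorelSpace E] (x : ℝ) :
    (stdGaussian E).real {z | 2 * Module.finrank ℝ E + 4 * x ≤ ‖z‖ ^ 2} ≤ Real.exp (-x) := by
  have hX : ∀ y : Fin (Module.finrank ℝ E) → ℝ, Real.exp (1 / 4 * ‖∑ i, y i • stdOrthonormalBasis ℝ E i‖ ^ 2) =
      ∏ i, Real.exp (1 / 4 * y i ^ 2) := by
    intro y
    have hin : ∀ j, ⟪stdOrthonormalBasis ℝ E j, ∑ i, y i • stdOrthonormalBasis ℝ E i⟫ = y j :=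
      fun j => (stdOrthonormalBasis ℝ E).orthonormal.inner_right_fintype y j
    rw [← Real.exp_sum, ← Finset.mul_sum,
      ← (stdOrthonormalBasis ℝ E).sum_sq_norm_inner_right (∑ i, y i • stdOrthonormalBasis ℝ E i)]
    simp only [hin, Real.norm_eq_abs, sq_abs]
  have hmap : AEMeasurable (fun y : Fin (Module.finrank ℝ E) → ℝ => ∑ i, y i • stdOrthonormalBasis ℝ E i)
      (Measure.pi fun _ => gaussianReal 0 1) :=
    Measurable.aemeasurable (by fun_prop)
  have hint : Integrable (fun z : E => Real.exp (1 / 4 * ‖z‖ ^ 2)) (stdGaussian E) := by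
    rw [stdGaussian, integrable_map_measure (by fun_prop) hmap]
    simp only [Function.comp_def, hX]
    exact Integrable.fintype_prod fun _ => integrable_exp_sq_gaussianReal.1
  have hval : mgf (fun z : E => ‖z‖ ^ 2) (stdGaussian E) (1 / 4) = √2 ^ Module.finrank ℝ E := by
    rw [mgf, stdGaussian, integral_map hmap (by fun_prop)]
    simp only [hX]
    rw [integral_fintype_prod_eq_prod (f := fun _ x => Real.exp (1 / 4 * x ^ 2))]
    simp only [integrable_exp_sq_gaussianReal.2, Finset.prod_const, Finset.card_univ,
      Fintype.card_fin]
  refine (measure_ge_le_exp_mul_mgf _ (by norm_num) hint).trans ?_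
  rw [hval]
  have h2 : √2 ≤ Real.exp (1 / 2) := by
    rw [Real.sqrt_le_left (by positivity), ← Real.exp_nat_mul]
    have := Real.add_one_le_exp (1 : ℝ)
    norm_num at this ⊢
    exact this
  calc Real.exp (-(1 / 4) * (2 * Module.finrank ℝ E + 4 * x)) * √2 ^ Module.finrank ℝ E
      ≤ Real.exp (-(1 / 4) * (2 * Module.finrank ℝ E + 4 * x)) * Real.exp (1 / 2) ^ Module.finrank ℝ E := by gcongr
    _ = Real.exp (-x) := by
      rw [← Real.exp_nat_mul, ← Real.exp_add]
      congr 1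
      ring

theorem stdGaussian_norm_starProjection_sq_ge_le (K : Submodule ℝ E) {s : ℝ}
    (hs : Module.finrank ℝ K ≤ s) (x : ℝ) :
    (stdGaussian E).real {z | 2 * s + 4 * x ≤ ‖K.starProjection z‖ ^ 2} ≤ Real.exp (-x) := by
  refine le_trans ?_ (stdGaussian_norm_sq_ge_le K x)
  rw [← map_orthogonalProjection_stdGaussian K, map_measureReal_apply (by fun_prop)
    (measurableSet_le (by fun_prop) (by fun_prop))]
  refine measureReal_mono fun z hz => ?_
  simp only [Set.mem_ofPred_eq, Set.mem_preimage, Submodule.starProjection_apply,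
    Submodule.coe_norm] at hz ⊢
  linarith

theorem hasLaw_smul_stdGaussian {Ω ι : Type*} [MeasurableSpace Ω] {P : Measure Ω} [Fintype ι]
    {σ : ℝ} (hσ : 0 < σ) {ε : Ω → EuclideanSpace ℝ ι}
    (hlaw : ∀ p, HasLaw (fun ω => ε ω p) (gaussianReal 0 (σ ^ 2).toNNReal) P)
    (hind : iIndepFun (fun p ω => ε ω p) P) :
    HasLaw (fun ω => σ⁻¹ • ε ω) (stdGaussian (EuclideanSpace ℝ ι)) P := by
  have hP : IsProbabilityMeasure P := hind.isProbabilityMeasure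
  have hm : ∀ p, AEMeasurable (fun ω => ε ω p) P := fun p => (hlaw p).aemeasurable
  have hlaw' : ∀ p, P.map (fun ω => σ⁻¹ * ε ω p) = gaussianReal 0 1 := by
    intro p
    have h := AEMeasurable.map_map_of_aemeasurable (μ := P) (f := fun ω => ε ω p)
      (g := fun x => σ⁻¹ * x) (by fun_prop) (hm p)
    rw [(hlaw p).map_eq, gaussianReal_map_const_mul] at h
    rw [show (fun ω => σ⁻¹ * ε ω p) = (fun x => σ⁻¹ * x) ∘ fun ω => ε ω p from rfl, ← h]
    congr 1
    · simp
    · ext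
      push_cast
      rw [Real.coe_toNNReal _ (sq_nonneg σ)]
      simp
      field_simp
  have hind' : iIndepFun (fun p ω => σ⁻¹ * ε ω p) P :=
    hind.comp (fun _ x => σ⁻¹ * x) fun _ => by fun_prop
  have hpi := (iIndepFun_iff_map_fun_eq_pi_map fun p => (hm p).const_mul σ⁻¹).1 hind'
  simp only [hlaw'] at hpi
  have hmpi : AEMeasurable (fun ω p => σ⁻¹ * ε ω p) P :=
    aemeasurable_pi_lambda _ fun p => (hm p).const_mul σ⁻¹
  have e : (fun ω => σ⁻¹ • ε ω) = WithLp.toLp 2 ∘ fun ω p => σ⁻¹ * ε ω p := by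
    ext ω p
    simp
  refine ⟨?_, ?_⟩
  · rw [e]
    exact (by fun_prop : Measurable (WithLp.toLp 2 : (ι → ℝ) → _)).comp_aemeasurable hmpi
  · rw [e, ← AEMeasurable.map_map_of_aemeasurable (by fun_prop) hmpi, hpi, map_pi_eq_stdGaussian]

end Gaussian

variable {n₁ n₂ : ℕ}

/-! ### Interaction terms -/

theorem interaction_apply (f : Image n₁ n₂) (q : Fin n₁ × Fin n₂) :
    interaction f q = f q - (∑ k, f (q.1, k)) / n₂ - (∑ j, f (j, q.2)) / n₁ + globalMean f := by
  simp only [interaction, rowEffect, colEffect]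
  ring

theorem interaction_add (f g : Image n₁ n₂) :
    interaction (f + g) = interaction f + interaction g := by
  ext q
  simp only [PiLp.add_apply, interaction_apply, globalMean, Finset.sum_add_distrib, add_div]
  ring

theorem interaction_smul (c : ℝ) (f : Image n₁ n₂) :
    interaction (c • f) = c • interaction f := by
  ext q
  simp only [PiLp.smul_apply, interaction_apply, globalMean, smul_eq_mul, ← Finset.mul_sum,
    mul_div_assoc]
  ring

/-- The interaction terms as a linear map. -/
def interactionHom (n₁ n₂ : ℕ) : Image n₁ n₂ →ₗ[ℝ] Image n₁ n₂ where
  toFun := interaction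
  map_add' := interaction_add
  map_smul' := interaction_smul

@[simp]
theorem interactionHom_apply (f : Image n₁ n₂) : interactionHom n₁ n₂ f = interaction f := rfl

theorem inner_image (f g : Image n₁ n₂) : inner ℝ f g = ∑ j, ∑ k, f (j, k) * g (j, k) := by
  rw [PiLp.inner_apply, Fintype.sum_prod_type]
  simp [mul_comm]

theorem inner_interaction_left (f g : Image n₁ n₂) :
    inner ℝ (interaction f) g = inner ℝ f (interaction g) := by
  -- The right-hand side is symmetric in `f` and `g`, which gives self-adjointness.
  have key : ∀ f g : Image n₁ n₂, inner ℝ (interaction f) g = inner ℝ f g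
      - (∑ j, (∑ k, f (j, k)) * ∑ k, g (j, k)) / n₂ - (∑ k, (∑ j, f (j, k)) * ∑ j, g (j, k)) / n₁
      + (∑ j, ∑ k, f (j, k)) * (∑ j, ∑ k, g (j, k)) / (n₁ * n₂) := by
    intro f g
    simp only [inner_image, interaction_apply, globalMean]
    have h1 : ∑ j, ∑ k, (∑ k', f (j, k')) / n₂ * g (j, k)
        = (∑ j, (∑ k, f (j, k)) * ∑ k, g (j, k)) / n₂ := by
      simp only [← Finset.mul_sum, div_mul_eq_mul_div, ← Finset.sum_div]
    have h2 : ∑ j, ∑ k, (∑ j', f (j', k)) / n₁ * g (j, k)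
        = (∑ k, (∑ j, f (j, k)) * ∑ j, g (j, k)) / n₁ := by
      rw [Finset.sum_comm]
      simp only [← Finset.mul_sum, div_mul_eq_mul_div, ← Finset.sum_div]
    simp only [add_mul, sub_mul, Finset.sum_add_distrib, Finset.sum_sub_distrib]
    rw [h1, h2]
    simp only [← Finset.mul_sum]
    ring
  rw [key, ← real_inner_comm f (interaction g), key, real_inner_comm]
  simp only [mul_comm]

theorem interaction_row (h₂ : 0 < n₂) (r : Fin n₁ → ℝ) :
    interaction (WithLp.toLp 2 fun q => r q.1 : Image n₁ n₂) = 0 := by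
  have : (n₂ : ℝ) ≠ 0 := by positivity
  ext q
  simp only [interaction_apply, globalMean, Finset.sum_const, Finset.card_univ, Fintype.card_fin,
    nsmul_eq_mul, PiLp.zero_apply, ← Finset.mul_sum]
  rcases eq_or_ne (n₁ : ℝ) 0 with h | h
  · simp [h]; field_simp; simp
  · field_simp; ring

theorem interaction_col (h₁ : 0 < n₁) (c : Fin n₂ → ℝ) :
    interaction (WithLp.toLp 2 fun q => c q.2 : Image n₁ n₂) = 0 := by
  have : (n₁ : ℝ) ≠ 0 := by positivity
  ext q
  simp only [interaction_apply, globalMean, Finset.sum_const, Finset.card_univ, Fintype.card_fin,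
    nsmul_eq_mul, PiLp.zero_apply]
  rcases eq_or_ne (n₂ : ℝ) 0 with h | h
  · simp [h]; field_simp; simp
  · field_simp; ring

theorem interaction_interaction (h₁ : 0 < n₁) (h₂ : 0 < n₂) (f : Image n₁ n₂) :
    interaction (interaction f) = interaction f := by
  have e : interaction f = f - (WithLp.toLp 2 fun q => globalMean f + rowEffect f q.1)
      - (WithLp.toLp 2 fun q => colEffect f q.2) := by
    ext q
    simp only [interaction, PiLp.sub_apply]
    ring
  have h := congrArg (interactionHom n₁ n₂) e
  rw [map_sub, map_sub] at h
  simp only [interactionHom_apply] at h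
  rw [interaction_row h₂ (fun j => globalMean f + rowEffect f j), interaction_col h₁] at h
  simpa using h

/-- Taking interaction terms is self-adjoint and idempotent, hence an orthogonal projection. -/
theorem norm_interaction_le (h₁ : 0 < n₁) (h₂ : 0 < n₂) (f : Image n₁ n₂) :
    ‖interaction f‖ ≤ ‖f‖ := by
  have h : ‖interaction f‖ * ‖interaction f‖ ≤ ‖f‖ * ‖interaction f‖ := by
    rw [← real_inner_self_eq_norm_mul_norm, inner_interaction_left,
      interaction_interaction h₁ h₂]
    exact real_inner_le_norm _ _
  rcases (norm_nonneg (interaction f)).eq_or_lt with h0 | h0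
  · rw [← h0]; positivity
  · exact le_of_mul_le_mul_right h h0

theorem delta_add (f g : Image n₁ n₂) (p : DIdx n₁ n₂) :
    delta (f + g) p = delta f p + delta g p := by
  simp only [delta, PiLp.add_apply]; ring

theorem delta_smul (c : ℝ) (f : Image n₁ n₂) (p : DIdx n₁ n₂) :
    delta (c • f) p = c * delta f p := by
  simp only [delta, PiLp.smul_apply, smul_eq_mul]; ring

theorem TV_add_le (f g : Image n₁ n₂) : TV (f + g) ≤ TV f + TV g := by
  simp only [TV, ← Finset.sum_add_distrib, delta_add]
  exact Finset.sum_le_sum fun _ _ => abs_add_le _ _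

theorem TV_smul (c : ℝ) (f : Image n₁ n₂) : TV (c • f) = |c| * TV f := by
  simp only [TV, delta_smul, abs_mul, Finset.mul_sum]

theorem TV_sub_le (f g : Image n₁ n₂) : TV (f - g) ≤ TV f + TV g := by
  have := TV_add_le f ((-1 : ℝ) • g)
  rw [TV_smul] at this
  simpa [← sub_eq_add_neg] using this

theorem TV_interaction (f : Image n₁ n₂) : TV (interaction f) = TV f := by
  refine Finset.sum_congr rfl fun p _ => ?_
  congr 1
  simp only [delta, interaction_apply]
  ring

/-- The decomposition of an image in the dictionary, up to main effects. -/
theorem interaction_eq_sum (h₁ : 0 < n₁) (h₂ : 0 < n₂) (f : Image n₁ n₂) :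
    interaction f = ∑ p, delta f p • tildeAtom p := by
  have e : ∑ p, delta f p • atom p = f - (WithLp.toLp 2 fun q => f (q.1, ⟨0, h₂⟩))
      - (WithLp.toLp 2 fun q => f (⟨0, h₁⟩, q.2) - f (⟨0, h₁⟩, ⟨0, h₂⟩)) := by
    ext q
    obtain ⟨⟨x, hx⟩, ⟨y, hy⟩⟩ := q
    -- Extension by zero to all of ℕ × ℕ, so that the double sum telescopes over ranges, in each
    -- direction in turn.
    set F : ℕ → ℕ → ℝ := fun a b => if h : a < n₁ ∧ b < n₂ then f (⟨a, h.1⟩, ⟨b, h.2⟩) else 0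
      with hF
    set G : ℕ → ℕ → ℝ := fun a b => F (a + 1) (b + 1) - F (a + 1) b - F a (b + 1) + F a b with hG
    have hFf : ∀ a b (ha : a < n₁) (hb : b < n₂), f (⟨a, ha⟩, ⟨b, hb⟩) = F a b := by
      intro a b ha hb
      simp [hF, ha, hb]
    have hd : ∀ p : DIdx n₁ n₂, delta f p = G p.1 p.2 := by
      intro p
      simp only [delta, hFf, hG]
    simp only [WithLp.ofLp_sum, Finset.sum_apply, PiLp.smul_apply, atom, smul_eq_mul, hd,
      mul_ite, mul_one, mul_zero, PiLp.sub_apply, hFf, ite_and, Fintype.sum_prod_type]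
    have hy' : ∀ a, ∑ b : Fin (n₂ - 1), (if (b : ℕ) + 1 ≤ y then G a b else 0) =
        (F (a + 1) y - F a y) - (F (a + 1) 0 - F a 0) := by
      intro a
      rw [Fin.sum_univ_eq_sum_range (fun b => if b + 1 ≤ y then G a b else 0), ← Finset.sum_filter,
        show (Finset.range (n₂ - 1)).filter (fun b => b + 1 ≤ y) = Finset.range y by
          ext b; simp; omega,
        ← Finset.sum_range_sub (fun b => F (a + 1) b - F a b)]
      exact Finset.sum_congr rfl fun b _ => by simp only [hG]; ring
    have : ∀ a : Fin (n₁ - 1), (∑ b : Fin (n₂ - 1), if (a : ℕ) + 1 ≤ x then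
        (if (b : ℕ) + 1 ≤ y then G a b else 0) else 0) =
        if (a : ℕ) + 1 ≤ x then (F (a + 1) y - F a y) - (F (a + 1) 0 - F a 0) else 0 := by
      intro a
      split_ifs
      · exact hy' a
      · simp
    rw [Finset.sum_congr rfl fun a _ => this a,
      Fin.sum_univ_eq_sum_range (fun a => if a + 1 ≤ x then
        (F (a + 1) y - F a y) - (F (a + 1) 0 - F a 0) else 0), ← Finset.sum_filter,
      show (Finset.range (n₁ - 1)).filter (fun a => a + 1 ≤ x) = Finset.range x by
          ext a; simp; omega, Finset.sum_sub_distrib,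
      Finset.sum_range_sub (fun a => F a y), Finset.sum_range_sub (fun a => F a 0)]
    ring
  -- The boundary terms of the telescoping depend on the row alone or on the column alone, so they
  -- have no interaction terms.
  have h := congrArg (interactionHom n₁ n₂) e
  rw [map_sub, map_sub, map_sum] at h
  simp only [interactionHom_apply, map_smul] at h
  rw [interaction_row h₂ (fun j => f (j, ⟨0, h₂⟩)),
    interaction_col h₁ (fun k => f (⟨0, h₁⟩, k) - f (⟨0, h₁⟩, ⟨0, h₂⟩))] at h
  simpa only [sub_zero, tildeAtom] using h.symm

/-! ### The mesh grid and its antiprojections -/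

/-- The outer product of two vectors. -/
def outer (u : Fin n₁ → ℝ) (v : Fin n₂ → ℝ) : Image n₁ n₂ := WithLp.toLp 2 fun q => u q.1 * v q.2

theorem norm_outer_sq (u : Fin n₁ → ℝ) (v : Fin n₂ → ℝ) :
    ‖outer u v‖ ^ 2 = (∑ i, u i ^ 2) * ∑ i, v i ^ 2 := by
  simp only [EuclideanSpace.real_norm_sq_eq, outer, Fintype.sum_prod_type, mul_pow,
    Finset.sum_mul_sum]

theorem norm_outer_le {u : Fin n₁ → ℝ} {v : Fin n₂ → ℝ} {a b : ℝ} (ha : ∑ i, u i ^ 2 ≤ a)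
    (hb : ∑ i, v i ^ 2 ≤ b) : ‖outer u v‖ ≤ √(a * b) := by
  refine Real.le_sqrt_of_sq_le ?_
  rw [norm_outer_sq]
  have : 0 ≤ ∑ i, v i ^ 2 := by positivity
  have : 0 ≤ ∑ i, u i ^ 2 := by positivity
  gcongr
  linarith

/-- A vector minus its mean. -/
def centered (u : Fin n₁ → ℝ) : Fin n₁ → ℝ := fun i => u i - (∑ j, u j) / n₁

theorem centered_sub (u v : Fin n₁ → ℝ) : centered (u - v) = centered u - centered v := by
  ext i
  simp only [centered, Pi.sub_apply, Finset.sum_sub_distrib, sub_div]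
  ring

theorem centered_const (h₁ : 0 < n₁) (c : ℝ) : centered (fun _ : Fin n₁ => c) = 0 := by
  ext i
  simp [centered]
  field_simp
  simp

/-- The sum of squares about the mean is at most that about any other point. -/
theorem sum_centered_sq_le (h₁ : 0 < n₁) (u : Fin n₁ → ℝ) (c : ℝ) :
    ∑ i, centered u i ^ 2 ≤ ∑ i, (u i - c) ^ 2 := by
  have hn : (0 : ℝ) < n₁ := by positivity
  set m := (∑ j, u j) / n₁ with hm
  have hs : ∑ j, u j = n₁ * m := by rw [hm]; field_simp
  have e : ∑ i, (u i - c) ^ 2 = ∑ i, centered u i ^ 2 + n₁ * (m - c) ^ 2 := by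
    have : ∀ i, (u i - c) ^ 2 = centered u i ^ 2 + 2 * (m - c) * (u i - m) + (m - c) ^ 2 := by
      intro i
      simp only [centered, ← hm]
      ring
    simp only [this, Finset.sum_add_distrib, ← Finset.mul_sum, Finset.sum_sub_distrib, hs,
      Finset.sum_const, Finset.card_univ, Fintype.card_fin, nsmul_eq_mul]
    ring
  rw [e]
  have := sq_nonneg (m - c)
  nlinarith

/-- Reduces the approximation of atoms to one-dimensional estimates on centered steps. -/
theorem interaction_outer (u : Fin n₁ → ℝ) (v : Fin n₂ → ℝ) :
    interaction (outer u v) = outer (centered u) (centered v) := by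
  ext q
  simp only [interaction_apply, globalMean, outer, centered, ← Finset.mul_sum, ← Finset.sum_mul]
  ring

/-- The indicator of the half-interval starting at `c`. -/
def step (n₁ c : ℕ) : Fin n₁ → ℝ := fun i => if c ≤ i then 1 else 0

theorem tildeAtom_eq (p : DIdx n₁ n₂) :
    tildeAtom p = outer (centered (step n₁ (p.1 + 1))) (centered (step n₂ (p.2 + 1))) := by
  rw [tildeAtom, ← interaction_outer]
  congr 1
  ext q
  simp [atom, outer, step, ← ite_and, and_comm]

theorem centered_step_zero (h₁ : 0 < n₁) : centered (step n₁ 0) = 0 := by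
  rw [← centered_const h₁ 1]
  congr 1

theorem centered_step_of_le (h₁ : 0 < n₁) {c : ℕ} (hc : n₁ ≤ c) : centered (step n₁ c) = 0 := by
  rw [← centered_const h₁ 0]
  congr 1
  ext i
  simp only [step, ite_eq_right_iff]
  omega

theorem sum_centered_step_sq_le (h₁ : 0 < n₁) (c : ℕ) :
    ∑ i, centered (step n₁ c) i ^ 2 ≤ (n₁ : ℝ) / 4 := by
  -- About 1/2, every entry of a step deviates by exactly 1/2.
  refine (sum_centered_sq_le h₁ _ (1 / 2)).trans_eq ?_
  have : ∀ i, (step n₁ c i - 1 / 2) ^ 2 = 1 / 4 := by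
    intro i
    unfold step
    split_ifs <;> norm_num
  rw [Finset.sum_congr rfl fun i _ => this i]
  simp
  linarith

theorem sum_step_sub_step_sq_le {a b : ℕ} (hab : a ≤ b) :
    ∑ i, (step n₁ a i - step n₁ b i) ^ 2 ≤ (b : ℝ) - a := by
  have h : ∀ i : Fin n₁, (step n₁ a i - step n₁ b i) ^ 2 =
      if (i : ℕ) ∈ Finset.Ico a b then 1 else 0 := by
    intro i
    simp only [step, Finset.mem_Ico]
    split_ifs <;> first | omega | norm_num
  simp only [h, Finset.sum_boole]
  have hc : (Finset.univ.filter fun i : Fin n₁ => (i : ℕ) ∈ Finset.Ico a b).card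
      ≤ (Finset.Ico a b).card :=
    Finset.card_le_card_of_injOn Fin.val (fun i hi => by simpa using hi)
      Fin.val_injective.injOn
  rw [Nat.card_Ico] at hc
  have : ((b - a : ℕ) : ℝ) = (b : ℝ) - a := Nat.cast_sub hab
  rw [← this]
  exact_mod_cast hc

theorem sum_centered_step_sub_sq_le (h₁ : 0 < n₁) (a b : ℕ) :
    ∑ i, (centered (step n₁ a) - centered (step n₁ b)) i ^ 2 ≤ |(a : ℝ) - b| := by
  rw [← centered_sub]
  refine (sum_centered_sq_le h₁ _ 0).trans ?_
  simp only [Pi.sub_apply, sub_zero]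
  rcases le_total a b with h | h
  · rw [abs_sub_comm]
    exact (sum_step_sub_step_sq_le h).trans (le_abs_self _)
  · simp only [sub_sq_comm (step n₁ a _)]
    exact (sum_step_sub_step_sq_le h).trans (le_abs_self _)

/-- Round down to a multiple of the mesh width. The value 0 is harmless: the step there is constant
and centers to zero. -/
theorem exists_fine {N t j : ℕ} (hdvd : t ^ 2 + 1 ∣ N) (hj : j < N) :
    ∃ c, (c = 0 ∨ c ∈ meshFine N t) ∧ |(j : ℝ) - c| ≤ ((N / (t ^ 2 + 1) : ℕ) : ℝ) := by
  obtain ⟨d, rfl⟩ := hdvd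
  have hd : 0 < d := by
    rcases Nat.eq_zero_or_pos d with rfl | h
    · simp at hj
    · exact h
  rw [meshFine, Nat.mul_div_cancel_left _ (by positivity)]
  refine ⟨j / d * d, ?_, ?_⟩
  · have h1 : j / d < t ^ 2 + 1 := (Nat.div_lt_iff_lt_mul hd).2 hj
    rcases Nat.eq_zero_or_pos (j / d) with h | h
    · left; simp [h]
    · right; exact ⟨j / d, h, by omega, rfl⟩
  · have h1 := Nat.div_add_mod' j d
    have h2 := Nat.mod_lt j hd
    have h3 : (j : ℝ) = ((j / d * d : ℕ) : ℝ) + ((j % d : ℕ) : ℝ) := by exact_mod_cast h1.symm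
    rw [h3, add_sub_cancel_left, Nat.abs_cast]
    exact_mod_cast h2.le

/-- With d the fine width, coarse points are the midpoints of t blocks of length td. The leftover
block of length d lies within d ≤ td/2 of `N` since t ≥ 2, and the step at `N` vanishes. -/
theorem exists_coarse {N t j : ℕ} (ht : 0 < t) (hteven : Even t) (hdvd : t ^ 2 + 1 ∣ N)
    (hj : j < N) :
    ∃ c, (c = N ∨ c ∈ meshCoarse N t) ∧
      |(j : ℝ) - c| ≤ t * ((N / (t ^ 2 + 1) : ℕ) : ℝ) / 2 := by
  obtain ⟨d, rfl⟩ := hdvd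
  obtain ⟨r, rfl⟩ := hteven
  have hd : 0 < d := by
    rcases Nat.eq_zero_or_pos d with rfl | h
    · simp at hj
    · exact h
  have hr : 1 ≤ r := by omega
  rw [meshCoarse, Nat.mul_div_cancel_left _ (by positivity)]
  have hT : 0 < (r + r) * d := by positivity
  have h1 := Nat.div_add_mod' j ((r + r) * d)
  have h2 := Nat.mod_lt j hT
  set i := j / ((r + r) * d)
  set m := j % ((r + r) * d)
  rcases lt_or_ge i (r + r) with h | h
  · refine ⟨(r + (r + r) * i) * d, Or.inr ⟨i, h, ?_⟩, ?_⟩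
    · congr 2; omega
    · have e : (j : ℝ) = i * ((r + r) * d) + m := by exact_mod_cast h1.symm
      have h2' : (m : ℝ) < (r + r) * d := by exact_mod_cast h2
      have h3 : (0 : ℝ) ≤ m := by positivity
      rw [e, abs_le]
      push_cast
      constructor <;> nlinarith
  · refine ⟨_, Or.inl rfl, ?_⟩
    have h3 : (r + r) * ((r + r) * d) ≤ j :=
      (Nat.mul_le_mul_right _ h).trans (by omega)
    have h3' : ((r : ℝ) + r) * ((r + r) * d) ≤ j := by exact_mod_cast h3
    have hj' : (j : ℝ) < ((r + r) ^ 2 + 1) * d := by exact_mod_cast hj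
    have hr' : (1 : ℝ) ≤ r := by exact_mod_cast hr
    have hd' : (0 : ℝ) < d := by exact_mod_cast hd
    rw [abs_le]
    push_cast
    constructor <;> nlinarith

theorem outer_mem_activeSpan {S : Set (DIdx n₁ n₂)} (h₁ : 0 < n₁) (h₂ : 0 < n₂) {a b : ℕ}
    (h : a = 0 ∨ n₁ ≤ a ∨ b = 0 ∨ n₂ ≤ b ∨ ∃ p ∈ S, p.1.val + 1 = a ∧ p.2.val + 1 = b) :
    outer (centered (step n₁ a)) (centered (step n₂ b)) ∈ activeSpan S := by
  have hz1 : ∀ v : Fin n₂ → ℝ, outer (0 : Fin n₁ → ℝ) v = 0 := by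
    intro v; ext; simp [outer]
  have hz2 : ∀ u : Fin n₁ → ℝ, outer u (0 : Fin n₂ → ℝ) = 0 := by
    intro v; ext; simp [outer]
  rcases h with rfl | h | rfl | h | ⟨p, hp, rfl, rfl⟩
  · simp [centered_step_zero h₁, hz1]
  · simp [centered_step_of_le h₁ h, hz1]
  · simp [centered_step_zero h₂, hz2]
  · simp [centered_step_of_le h₂ h, hz2]
  · rw [← tildeAtom_eq]
    exact Submodule.subset_span ⟨p, hp, rfl⟩

theorem meshFine_subset {N t c : ℕ} (hN : 0 < N) (hdvd : t ^ 2 + 1 ∣ N) (hc : c ∈ meshFine N t) :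
    1 ≤ c ∧ c < N := by
  obtain ⟨d, rfl⟩ := hdvd
  rw [meshFine, Nat.mul_div_cancel_left _ (by positivity)] at hc
  obtain ⟨m, h1, h2, rfl⟩ := hc
  have hd : 0 < d := Nat.pos_of_mul_pos_left hN
  exact ⟨by nlinarith, by nlinarith⟩

theorem meshCoarse_subset_meshFine {N t c : ℕ} (ht : 0 < t) (hteven : Even t)
    (hc : c ∈ meshCoarse N t) : c ∈ meshFine N t := by
  obtain ⟨i, hi, rfl⟩ := hc
  obtain ⟨r, rfl⟩ := hteven
  have : (r + r + 1) / 2 = r := by omega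
  refine ⟨_, ?_, ?_, rfl⟩ <;> rw [this]
  · nlinarith
  · nlinarith

theorem mesh_index {a b : ℕ} {S : Set (DIdx n₁ n₂)} (ha : 1 ≤ a ∧ a < n₁) (hb : 1 ≤ b ∧ b < n₂)
    (h : ∀ p : DIdx n₁ n₂, p.1.val + 1 = a → p.2.val + 1 = b → p ∈ S) :
    ∃ p ∈ S, p.1.val + 1 = a ∧ p.2.val + 1 = b := by
  refine ⟨(⟨a - 1, by omega⟩, ⟨b - 1, by omega⟩), h _ ?_ ?_, ?_, ?_⟩ <;>
    simp only <;> omega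

/-- With fine neighbours a, b and coarse neighbours a′, b′ of the two coordinates, the atom is
approximated by (a,b′) + (a′,b) − (a′,b′), all in the active span. The error is a product of two
coarse errors plus two terms pairing a fine error with a full step. Each has norm at most n₁/(2t),
and dividing by √n = n₁ yields 3/(2t). -/
theorem isAntiprojectionBound_meshGrid {t : ℕ} (h₁ : 0 < n₁) (ht : 0 < t) (hteven : Even t)
    (hdvd : t ^ 2 + 1 ∣ n₁) :
    IsAntiprojectionBound (meshGrid n₁ n₁ t t) fun _ => 3 / (2 * (t : ℝ)) := by
  intro p
  obtain ⟨a, ha, haj⟩ := exists_fine (j := p.1.val + 1) hdvd (by omega)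
  obtain ⟨b, hb, hbj⟩ := exists_fine (j := p.2.val + 1) hdvd (by omega)
  obtain ⟨a', ha', haj'⟩ := exists_coarse (j := p.1.val + 1) ht hteven hdvd (by omega)
  obtain ⟨b', hb', hbj'⟩ := exists_coarse (j := p.2.val + 1) ht hteven hdvd (by omega)
  set S := meshGrid n₁ n₁ t t with hS
  set d : ℝ := ((n₁ / (t ^ 2 + 1) : ℕ) : ℝ) with hd
  set c : ℕ → Fin n₁ → ℝ := fun j => centered (step n₁ j) with hc
  have hfine : ∀ {x}, x ∈ meshFine n₁ t → 1 ≤ x ∧ x < n₁ := meshFine_subset h₁ hdvd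
  have hcf : ∀ {x}, x ∈ meshCoarse n₁ t → x ∈ meshFine n₁ t :=
    meshCoarse_subset_meshFine ht hteven
  have hFC : ∀ x y, (x = 0 ∨ x ∈ meshFine n₁ t) → (y = n₁ ∨ y ∈ meshCoarse n₁ t) →
      outer (c x) (c y) ∈ activeSpan S := by
    intro x y hx hy
    refine outer_mem_activeSpan h₁ h₁ ?_
    rcases hx with rfl | hx
    · simp
    rcases hy with rfl | hy
    · simp
    refine Or.inr <| Or.inr <| Or.inr <| Or.inr <| mesh_index (hfine hx) (hfine (hcf hy)) ?_
    rintro q rfl rfl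
    exact Or.inl ⟨hx, hy⟩
  have hCF : ∀ x y, (x = n₁ ∨ x ∈ meshCoarse n₁ t) → (y = 0 ∨ y ∈ meshFine n₁ t) →
      outer (c x) (c y) ∈ activeSpan S := by
    intro x y hx hy
    refine outer_mem_activeSpan h₁ h₁ ?_
    rcases hx with rfl | hx
    · simp
    rcases hy with rfl | hy
    · simp
    refine Or.inr <| Or.inr <| Or.inr <| Or.inr <| mesh_index (hfine (hcf hx)) (hfine hy) ?_
    rintro q rfl rfl
    exact Or.inr ⟨hx, hy⟩
  -- For even t every coarse point is also a fine one, so coarse-coarse pairs are active.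
  have hCC : outer (c a') (c b') ∈ activeSpan S := by
    rcases hb' with rfl | hb'
    · exact outer_mem_activeSpan h₁ h₁ (by simp)
    · exact hCF _ _ ha' (Or.inr (hcf hb'))
  have hg : outer (c a) (c b') + outer (c a') (c b) - outer (c a') (c b') ∈ activeSpan S :=
    sub_mem (add_mem (hFC _ _ ha hb') (hCF _ _ ha' hb)) hCC
  set g := outer (c a) (c b') + outer (c a') (c b) - outer (c a') (c b')
  have hmin : ‖tildeAtom p - (activeSpan S).starProjection (tildeAtom p)‖ ≤ ‖tildeAtom p - g‖ := by
    rw [Submodule.starProjection_minimal]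
    exact ciInf_le ⟨0, by rintro _ ⟨x, rfl⟩; positivity⟩ (⟨g, hg⟩ : activeSpan S)
  have hdec : tildeAtom p - g =
      outer (c (p.1 + 1) - c a') (c (p.2 + 1) - c b') + outer (c (p.1 + 1) - c a) (c b')
        + outer (c a') (c (p.2 + 1) - c b) := by
    rw [tildeAtom_eq]
    ext q
    simp only [g, outer, PiLp.sub_apply, PiLp.add_apply, Pi.sub_apply, hc]
    ring
  have b1 := norm_outer_le ((sum_centered_step_sub_sq_le h₁ (p.1 + 1) a').trans haj')
    ((sum_centered_step_sub_sq_le h₁ (p.2 + 1) b').trans hbj')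
  have b2 := norm_outer_le ((sum_centered_step_sub_sq_le h₁ (p.1 + 1) a).trans haj)
    (sum_centered_step_sq_le h₁ b')
  have b3 := norm_outer_le (sum_centered_step_sq_le h₁ a')
    ((sum_centered_step_sub_sq_le h₁ (p.2 + 1) b).trans hbj)
  have hd0 : 0 ≤ d := by positivity
  have hnd : (n₁ : ℝ) = (t ^ 2 + 1) * d := by
    rw [hd]
    exact_mod_cast (Nat.mul_div_cancel' hdvd).symm
  have ht' : (0 : ℝ) < t := by positivity
  have hn : (0 : ℝ) < n₁ := by positivity
  rw [Real.sqrt_mul_self (by positivity)] at b1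
  have hq : √(d * (n₁ / 4)) ≤ n₁ / (2 * t) := by
    refine Real.sqrt_le_iff.2 ⟨by positivity, ?_⟩
    rw [div_pow, le_div_iff₀ (by positivity)]
    have : d * t ^ 2 ≤ n₁ := by rw [hnd]; linarith
    nlinarith
  rw [mul_comm (n₁ / 4 : ℝ)] at b3
  have hq1 : t * d / 2 ≤ n₁ / (2 * t) := by
    rw [div_le_div_iff₀ (by norm_num) (by positivity), hnd]
    nlinarith
  rw [Real.sqrt_mul_self hn.le, div_le_iff₀ hn]
  calc _ ≤ ‖tildeAtom p - g‖ := hmin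
    _ ≤ t * d / 2 + √(d * (n₁ / 4)) + √(d * (n₁ / 4)) := by
      rw [hdec]
      exact (norm_add₃_le).trans (add_le_add (add_le_add b1 b2) b3)
    _ ≤ n₁ / (2 * t) + n₁ / (2 * t) + n₁ / (2 * t) := by gcongr
    _ = 3 / (2 * (t : ℝ)) * n₁ := by field_simp; norm_num

theorem finrank_activeSpan_meshGrid_le (n₁ t : ℕ) :
    Module.finrank ℝ (activeSpan (meshGrid n₁ n₁ t t)) ≤ meshSize t t := by
  classical
  -- The subtraction of 1 passes from a pixel coordinate to its index in `DIdx`. Counting both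
  -- products without removing their overlap gives 2t³.
  set A : Finset ℕ := (Finset.Icc 1 (t ^ 2)).image fun m => m * (n₁ / (t ^ 2 + 1)) - 1
  set B : Finset ℕ := (Finset.range t).image
    fun i => ((t + 1) / 2 + t * i) * (n₁ / (t ^ 2 + 1)) - 1
  have hA : A.card ≤ t ^ 2 := Finset.card_image_le.trans (by simp)
  have hB : B.card ≤ t := Finset.card_image_le.trans (by simp)
  have hfA : ∀ x, x + 1 ∈ meshFine n₁ t → x ∈ A := by
    rintro x ⟨m, h1, h2, h3⟩
    exact Finset.mem_image.2 ⟨m, Finset.mem_Icc.2 ⟨h1, h2⟩, by omega⟩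
  have hfB : ∀ x, x + 1 ∈ meshCoarse n₁ t → x ∈ B := by
    rintro x ⟨i, h1, h3⟩
    exact Finset.mem_image.2 ⟨i, Finset.mem_range.2 h1, by omega⟩
  have hfin : (meshGrid n₁ n₁ t t).ncard ≤ (A ×ˢ B ∪ B ×ˢ A).card := by
    rw [← Set.ncard_coe_finset]
    refine Set.ncard_le_ncard_of_injOn (fun p => (p.1.val, p.2.val)) ?_ ?_
    · rintro p (⟨h1, h2⟩ | ⟨h1, h2⟩)
      · simp [hfA _ h1, hfB _ h2]
      · simp [hfB _ h1, hfA _ h2]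
    · rintro ⟨⟨x, _⟩, ⟨y, _⟩⟩ _ ⟨⟨x', _⟩, ⟨y', _⟩⟩ _ h
      simpa using h
  have h1 : Module.finrank ℝ (activeSpan (meshGrid n₁ n₁ t t)) ≤ (meshGrid n₁ n₁ t t).ncard := by
    have hfinite : (tildeAtom '' meshGrid n₁ n₁ t t).Finite := Set.toFinite _
    have := hfinite.fintype
    refine (finrank_span_le_card (R := ℝ) (tildeAtom '' meshGrid n₁ n₁ t t)).trans ?_
    rw [← Set.ncard_eq_toFinset_card']
    exact Set.ncard_image_le
  refine h1.trans (hfin.trans ((Finset.card_union_le _ _).trans ?_))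
  rw [Finset.card_product, Finset.card_product, meshSize]
  have := Nat.mul_le_mul hA hB
  nlinarith

/-! ### The oracle inequality -/

/-- First-order optimality without differentiating: compare with points on the segment towards `f`,
where TV is convex and the quadratic remainder is of order s². -/
theorem inner_residual_le (h₁ : 0 < n₁) (h₂ : 0 < n₂) {lam : ℝ} (hlam : 0 ≤ lam)
    {y fhat : Image n₁ n₂} (hmin : ∀ f, objective lam y fhat ≤ objective lam y f)
    (f : Image n₁ n₂) :
    inner ℝ (y - fhat) (f - fhat) ≤ (n₁ : ℝ) * n₂ * lam * (TV f - TV fhat) := by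
  have hn : (0 : ℝ) < (n₁ : ℝ) * n₂ := by positivity
  set W := ‖f - fhat‖ ^ 2 with hW
  set D := 2 * inner ℝ (y - fhat) (f - fhat) - 2 * ((n₁ : ℝ) * n₂ * lam * (TV f - TV fhat))
    with hD
  have key : ∀ s : ℝ, 0 < s → s ≤ 1 → D ≤ s * W := by
    intro s hs hs1
    have h := hmin (fhat + s • (f - fhat))
    have hT : TV (fhat + s • (f - fhat)) ≤ (1 - s) * TV fhat + s * TV f := by
      have e : fhat + s • (f - fhat) = (1 - s) • fhat + s • f := by module
      rw [e]
      refine (TV_add_le _ _).trans_eq ?_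
      rw [TV_smul, TV_smul, abs_of_nonneg hs.le, abs_of_nonneg (by linarith)]
    have hN : ‖y - (fhat + s • (f - fhat))‖ ^ 2 =
        ‖y - fhat‖ ^ 2 - 2 * (s * inner ℝ (y - fhat) (f - fhat)) + s ^ 2 * W := by
      rw [← sub_sub, norm_sub_sq_real, real_inner_smul_right, norm_smul, mul_pow,
        Real.norm_eq_abs, sq_abs]
    simp only [objective, hN] at h
    have hT' := mul_le_mul_of_nonneg_left hT hlam
    have h' : ‖y - fhat‖ ^ 2 / ((n₁ : ℝ) * n₂) ≤
        (‖y - fhat‖ ^ 2 - 2 * (s * inner ℝ (y - fhat) (f - fhat)) + s ^ 2 * W) / ((n₁ : ℝ) * n₂)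
          + 2 * (lam * s * (TV f - TV fhat)) := by
      linarith
    rw [div_add' _ _ _ hn.ne', div_le_div_iff_of_pos_right hn] at h'
    have : s * D ≤ s * (s * W) := by
      rw [hD]
      linarith
    exact le_of_mul_le_mul_left this hs
  have hD0 : D ≤ 0 := by
    by_contra! h
    -- If D were positive, s = 1 would give D ≤ W, making s = D/(2W) admissible; it yields D ≤ D/2.
    have hWD := key 1 one_pos le_rfl
    have hW0 : 0 < W := by linarith
    have := key (D / (2 * W)) (by positivity) (by rw [div_le_one (by positivity)]; linarith)
    have e : D / (2 * W) * W = D / 2 := by field_simp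
    linarith
  linarith

/-- On the event where the noise is dominated on the antiprojections of the atoms, the error of
the estimator is bounded by the projected noise and the total variation of the image. -/
theorem norm_interactionEstimator_sub_sq_le (h₁ : 0 < n₁) (h₂ : 0 < n₂) {lam : ℝ}
    (hlam : 0 ≤ lam) (S : Set (DIdx n₁ n₂)) (f₀ e : Image n₁ n₂)
    (he : ∀ p, |inner ℝ (tildeAtom p - (activeSpan S).starProjection (tildeAtom p)) e| ≤
      (n₁ : ℝ) * n₂ * lam) :
    ‖interactionEstimator lam (f₀ + e) - interaction f₀‖ ^ 2 ≤
      ‖(activeSpan S).starProjection e‖ ^ 2 + 4 * ((n₁ : ℝ) * n₂ * lam * TV f₀) := by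
  set K := activeSpan S
  set fhat := interactionEstimator lam (f₀ + e) with hfhat
  set δ := fhat - interaction f₀ with hδ
  have hn : (0 : ℝ) < (n₁ : ℝ) * n₂ := by positivity
  have hb := inner_residual_le h₁ h₂ hlam (interactionEstimator_spec h₁ h₂ hlam (f₀ + e))
    (interaction f₀)
  rw [interaction_add, ← hfhat, TV_interaction,
    show interaction f₀ + interaction e - fhat = interaction e - δ by rw [hδ]; abel,
    show interaction f₀ - fhat = -δ by rw [hδ]; abel, inner_neg_right, inner_sub_left,
    real_inner_self_eq_norm_sq, inner_interaction_left] at hb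
  have hTV : TV δ ≤ TV fhat + TV f₀ := by
    rw [← TV_interaction f₀]
    exact TV_sub_le _ _
  have hsplit : interaction δ = K.starProjection (interaction δ) +
      ∑ p, delta δ p • (tildeAtom p - K.starProjection (tildeAtom p)) := by
    simp only [smul_sub, Finset.sum_sub_distrib, ← map_smul, ← map_sum]
    rw [← interaction_eq_sum h₁ h₂ δ]
    abel
  have hproj : inner ℝ e (K.starProjection (interaction δ)) ≤ ‖K.starProjection e‖ * ‖δ‖ := by
    rw [← Submodule.inner_starProjection_left_eq_right]
    exact (real_inner_le_norm _ _).trans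
      (mul_le_mul_of_nonneg_left (norm_interaction_le h₁ h₂ δ) (norm_nonneg _))
  have hanti : inner ℝ e (∑ p, delta δ p • (tildeAtom p - K.starProjection (tildeAtom p))) ≤
      (n₁ : ℝ) * n₂ * lam * TV δ := by
    rw [inner_sum, TV, Finset.mul_sum]
    refine Finset.sum_le_sum fun p _ => (le_abs_self _).trans ?_
    rw [real_inner_smul_right, abs_mul, mul_comm, real_inner_comm]
    exact mul_le_mul_of_nonneg_right (he p) (abs_nonneg _)
  have hin : inner ℝ e (interaction δ) ≤
      ‖K.starProjection e‖ * ‖δ‖ + (n₁ : ℝ) * n₂ * lam * TV δ := by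
    rw [hsplit, inner_add_right]
    exact add_le_add hproj hanti
  have hTV' := mul_le_mul_of_nonneg_left hTV (mul_nonneg hn.le hlam)
  -- Half of ‖δ‖² is absorbed on the left; the resulting doubling turns 2nλ TV(f⁰) into 4nλ TV(f⁰).
  have hsq := two_mul_le_add_sq ‖K.starProjection e‖ ‖δ‖
  linarith

theorem one_sub_inv_le_measureReal_mse_le {Ω : Type*} [MeasurableSpace Ω] {P : Measure Ω}
    (h₁ : 0 < n₁) (h₂ : 0 < n₂) {σ : ℝ} (hσ : 0 < σ) (f₀ : Image n₁ n₂)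
    {ε : Ω → Image n₁ n₂}
    (hε_law : ∀ p, HasLaw (fun ω => ε ω p) (gaussianReal 0 (σ ^ 2).toNNReal) P)
    (hε_indep : iIndepFun (fun p ω => ε ω p) P) {S : Set (DIdx n₁ n₂)} {v₀ lam s : ℝ}
    (hv₀ : 0 < v₀) (hv : IsAntiprojectionBound S fun _ => v₀)
    (hs : Module.finrank ℝ (activeSpan S) ≤ s) {n : ℝ} (hn : n = (n₁ : ℝ) * n₂)
    (hlam : v₀ * lambda0 σ n (Real.log (2 * n)) ≤ lam) :
    1 - 1 / n ≤ P.real {ω |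
      ‖interactionEstimator lam (f₀ + ε ω) - interaction f₀‖ ^ 2 / n ≤
        4 * lam * TV f₀ + 2 * σ ^ 2 * s / n + 4 * σ ^ 2 * Real.log (2 * n) / n} := by
  have hP : IsProbabilityMeasure P := hε_indep.isProbabilityMeasure
  have hn1 : 1 ≤ n := by
    rw [hn]
    exact_mod_cast Nat.mul_pos h₁ h₂
  have hn0 : 0 < n := by linarith
  set y := Real.log (2 * n) with hy
  have hy0 : 0 ≤ y := Real.log_nonneg (by linarith)
  have hey : Real.exp (-y) = 1 / (2 * n) := by
    rw [Real.exp_neg, hy, Real.exp_log (by positivity), one_div]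
  have hey2 : Real.exp (-(2 * y)) = (1 / (2 * n)) ^ 2 := by
    rw [← hey, ← Real.exp_nat_mul]
    congr 1
    push_cast
    ring
  have hlam0 : 0 ≤ lam := by
    refine le_trans ?_ hlam
    unfold lambda0
    positivity
  set K := activeSpan S
  set w : DIdx n₁ n₂ → Image n₁ n₂ := fun p => tildeAtom p - K.starProjection (tildeAtom p)
    with hw
  have hc : 0 < v₀ * √n := by positivity
  have hwc : ∀ p, ‖w p‖ ≤ v₀ * √n := by
    intro p
    have := hv p
    rwa [← hn, div_le_iff₀ (by positivity)] at this
  set A : Set (Image n₁ n₂) := {z | 2 * s + 4 * y ≤ ‖K.starProjection z‖ ^ 2}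
  set B : DIdx n₁ n₂ → Set (Image n₁ n₂) :=
    fun p => {z | v₀ * √n * √(2 * (2 * y)) ≤ |inner ℝ (w p) z|}
  have hA : (stdGaussian (Image n₁ n₂)).real A ≤ 1 / (2 * n) :=
    (stdGaussian_norm_starProjection_sq_ge_le K hs y).trans_eq hey
  -- At most n atoms, each failing with probability at most 2 exp(−2y) = 2/(2n)². One y in the
  -- exponent pays for the union bound, the other for the confidence level.
  have hB : (stdGaussian (Image n₁ n₂)).real (⋃ p, B p) ≤ 1 / (2 * n) := by
    refine (measureReal_iUnion_fintype_le _).trans ?_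
    refine (Finset.sum_le_sum fun p _ =>
      stdGaussian_abs_inner_ge_le hc (by positivity) (hwc p)).trans ?_
    rw [Finset.sum_const, Finset.card_univ, nsmul_eq_mul, hey2]
    have hcard : (Fintype.card (DIdx n₁ n₂) : ℝ) ≤ n := by
      rw [hn, Fintype.card_prod, Fintype.card_fin, Fintype.card_fin]
      exact_mod_cast Nat.mul_le_mul (Nat.sub_le _ _) (Nat.sub_le _ _)
    calc _ ≤ n * (2 * (1 / (2 * n)) ^ 2) := by gcongr
      _ = 1 / (2 * n) := by field_simp
  have hmeas : MeasurableSet (A ∪ ⋃ p, B p) :=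
    (measurableSet_le (by fun_prop) (by fun_prop)).union
      (MeasurableSet.iUnion fun p => measurableSet_le (by fun_prop) (by fun_prop))
  have hZ := hasLaw_smul_stdGaussian hσ hε_law hε_indep
  have hbad : (stdGaussian (Image n₁ n₂)).real (A ∪ ⋃ p, B p) ≤ 1 / n := by
    refine (measureReal_union_le _ _).trans ((add_le_add hA hB).trans_eq ?_)
    field_simp
    norm_num
  have hgood : 1 - 1 / n ≤ (stdGaussian (Image n₁ n₂)).real (A ∪ ⋃ p, B p)ᶜ := by
    rw [probReal_compl_eq_one_sub hmeas]
    linarith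
  rw [← hZ.map_eq, map_measureReal_apply_of_aemeasurable hZ.aemeasurable hmeas.compl] at hgood
  refine hgood.trans (measureReal_mono fun ω hω => ?_)
  have hω' : σ⁻¹ • ε ω ∉ A ∪ ⋃ p, B p := hω
  simp only [Set.mem_union, Set.mem_iUnion, not_or, not_exists] at hω'
  have hε : ε ω = σ • (σ⁻¹ • ε ω) := by rw [smul_inv_smul₀ hσ.ne']
  set z := σ⁻¹ • ε ω
  have hzA : ‖K.starProjection z‖ ^ 2 < 2 * s + 4 * y := not_le.1 hω'.1
  have hzB : ∀ p, |inner ℝ (w p) z| < v₀ * √n * √(2 * (2 * y)) := fun p => not_le.1 (hω'.2 p)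
  have hl0 : v₀ * √n * √(2 * (2 * y)) * σ ≤ n * lam := by
    refine le_trans (le_of_eq ?_) (mul_le_mul_of_nonneg_left hlam hn0.le)
    rw [lambda0, Real.sqrt_div (by positivity), show 2 * y + 2 * y = 2 * (2 * y) by ring]
    have hs0 : √n ≠ 0 := by positivity
    field_simp
    rw [Real.sq_sqrt hn0.le, mul_comm]
  have h := norm_interactionEstimator_sub_sq_le h₁ h₂ hlam0 S f₀ (ε ω) (fun p => by
    rw [hε, real_inner_smul_right, abs_mul, abs_of_pos hσ, ← hn, mul_comm]
    exact (mul_le_mul_of_nonneg_right (hzB p).le hσ.le).trans hl0)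
  have hKe : ‖K.starProjection (ε ω)‖ ^ 2 ≤ σ ^ 2 * (2 * s + 4 * y) := by
    rw [hε, map_smul, norm_smul, mul_pow, Real.norm_eq_abs, sq_abs]
    gcongr
  change _ / n ≤ _
  rw [← hn] at h
  calc _ ≤ (σ ^ 2 * (2 * s + 4 * y) + 4 * (n * lam * TV f₀)) / n := by gcongr; linarith
    _ = _ := by field_simp; ring

/-! ### The choice of the mesh and of the tuning parameter -/

/-- The ideal size of the active set for images of total variation `V`. -/
def idealSize (σ n V : ℝ) : ℝ :=
  2 ^ (5 / 4 : ℝ) * 3 ^ (3 / 4 : ℝ) * Real.log (2 * n) ^ (3 / 8 : ℝ) * n ^ (3 / 8 : ℝ)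
    * V ^ (3 / 4 : ℝ) / σ ^ (3 / 4 : ℝ)

/-- The tuning parameter that goes with `idealSize`. -/
def idealTuning (σ n V : ℝ) : ℝ :=
  3 ^ (3 / 4 : ℝ) * σ ^ (5 / 4 : ℝ) * Real.log (2 * n) ^ (3 / 8 : ℝ)
    / (2 ^ (1 / 12 : ℝ) * n ^ (5 / 8 : ℝ) * V ^ (1 / 4 : ℝ))

theorem inverseScaling_le (S : Set (DIdx n₁ n₂)) {v₀ : ℝ} (hv₀ : 0 ≤ v₀) :
    inverseScaling S (fun _ => v₀) ≤ v₀ := by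
  refine (pi_norm_le_iff_of_nonneg hv₀).2 fun p => ?_
  by_cases hp : p ∈ Sᶜ <;> simp [hp, abs_of_nonneg, hv₀]

/-- Equality holds when 2t³ equals the ideal size, and the left side decreases in t. Writing
everything in suitable roots of L, n, σ, V, 2 and 3 turns the claim into an inequality between
monomials. -/
theorem lambda0_le_idealTuning {σ n V t : ℝ} (hσ : 0 < σ) (hn : 1 ≤ n) (hV : 0 < V) (ht : 0 < t)
    (hX : idealSize σ n V ≤ 2 * t ^ 3) :
    3 / (2 * t) * lambda0 σ n (Real.log (2 * n)) ≤ idealTuning σ n V := by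
  have hn0 : 0 < n := by linarith
  unfold idealSize at hX
  unfold idealTuning lambda0
  have hL : 0 < Real.log (2 * n) := Real.log_pos (by linarith)
  set L := Real.log (2 * n)
  have hpow : ∀ {x : ℝ}, 0 < x → ∀ (a b : ℝ) (k : ℕ), b = a * k → x ^ b = (x ^ a) ^ k := by
    intro x hx a b k h
    rw [h, Real.rpow_mul hx.le, Real.rpow_natCast]
  rw [hpow hL (1 / 8) _ 3 (by norm_num), hpow hn0 (1 / 8) _ 3 (by norm_num),
    hpow hV (1 / 4) _ 3 (by norm_num), hpow hσ (1 / 4) _ 3 (by norm_num),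
    hpow two_pos (1 / 12) _ 15 (by norm_num), hpow three_pos (1 / 4) _ 3 (by norm_num)] at hX
  rw [hpow hL (1 / 8) _ 3 (by norm_num), hpow hn0 (1 / 8) _ 5 (by norm_num),
    hpow hσ (1 / 4) (5 / 4) 5 (by norm_num), hpow three_pos (1 / 4) (3 / 4) 3 (by norm_num)]
  have eL : L = (L ^ (1 / 8 : ℝ)) ^ 8 := by rw [← hpow hL _ 1 _ (by norm_num), Real.rpow_one]
  have en : n = (n ^ (1 / 8 : ℝ)) ^ 8 := by rw [← hpow hn0 _ 1 _ (by norm_num), Real.rpow_one]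
  have eσ : σ = (σ ^ (1 / 4 : ℝ)) ^ 4 := by rw [← hpow hσ _ 1 _ (by norm_num), Real.rpow_one]
  have e2 : ((2 : ℝ) ^ (1 / 12 : ℝ)) ^ 12 = 2 := by
    rw [← hpow two_pos _ 1 _ (by norm_num), Real.rpow_one]
  have e3 : ((3 : ℝ) ^ (1 / 4 : ℝ)) ^ 4 = 3 := by
    rw [← hpow three_pos _ 1 _ (by norm_num), Real.rpow_one]
  have hl : 0 < L ^ (1 / 8 : ℝ) := by positivity
  have hm : 0 < n ^ (1 / 8 : ℝ) := by positivity
  have hq : 0 < σ ^ (1 / 4 : ℝ) := by positivity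
  have hu : 0 < V ^ (1 / 4 : ℝ) := by positivity
  have hb : 0 < (2 : ℝ) ^ (1 / 12 : ℝ) := by positivity
  have ha : 0 < (3 : ℝ) ^ (1 / 4 : ℝ) := by positivity
  generalize L ^ (1 / 8 : ℝ) = l at *
  generalize n ^ (1 / 8 : ℝ) = m at *
  generalize σ ^ (1 / 4 : ℝ) = q at *
  generalize V ^ (1 / 4 : ℝ) = u at *
  generalize (2 : ℝ) ^ (1 / 12 : ℝ) = b at *
  generalize (3 : ℝ) ^ (1 / 4 : ℝ) = a at *
  have hsqrt : √((2 * L + 2 * L) / n) = 2 * l ^ 4 / m ^ 4 := by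
    rw [eL, en, show (2 * l ^ 8 + 2 * l ^ 8) / m ^ 8 = (2 * l ^ 4 / m ^ 4) ^ 2 by field_simp; ring]
    exact Real.sqrt_sq (by positivity)
  rw [hsqrt, eσ, show 3 / (2 * t) * (q ^ 4 * (2 * l ^ 4 / m ^ 4)) = 3 * q ^ 4 * l ^ 4 / m ^ 4 / t by
    field_simp, div_le_iff₀ ht]
  -- The hypothesis bounds t³, so cubes are compared; b¹² = 2 accounts for the factor in 2t³.
  refine le_of_pow_le_pow_left₀ three_ne_zero (by positivity) ?_
  have h3 : b ^ 15 * a ^ 3 * l ^ 3 * m ^ 3 * u ^ 3 / q ^ 3 / b ^ 12 ≤ t ^ 3 := by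
    rw [e2]
    linarith
  calc (3 * q ^ 4 * l ^ 4 / m ^ 4) ^ 3
      = (a ^ 4 * q ^ 4 * l ^ 4 / m ^ 4) ^ 3 := by rw [e3]
    _ = (a ^ 3 * q ^ 5 * l ^ 3 / (b * m ^ 5 * u)) ^ 3
        * (b ^ 15 * a ^ 3 * l ^ 3 * m ^ 3 * u ^ 3 / q ^ 3 / b ^ 12) := by field_simp
    _ ≤ (a ^ 3 * q ^ 5 * l ^ 3 / (b * m ^ 5 * u)) ^ 3 * t ^ 3 := by gcongr
    _ = (a ^ 3 * q ^ 5 * l ^ 3 / (b * m ^ 5 * u) * t) ^ 3 := by ring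

theorem idealSize_mul_le {σ n V : ℝ} (hσ : 0 < σ) (hn : 1 ≤ n) (hV : 0 < V) :
    σ ^ 2 * idealSize σ n V / n ≤
      5.422 * (σ ^ (5 / 4 : ℝ) * V ^ (3 / 4 : ℝ) * Real.log (2 * n) ^ (3 / 8 : ℝ)
        / n ^ (5 / 8 : ℝ)) := by
  have hn0 : 0 < n := by linarith
  have hL : 0 < Real.log (2 * n) := Real.log_pos (by linarith)
  have hκ : (2 : ℝ) ^ (5 / 4 : ℝ) * 3 ^ (3 / 4 : ℝ) ≤ 5.422 := by
    refine le_of_pow_le_pow_left₀ four_ne_zero (by norm_num) ?_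
    rw [mul_pow, ← Real.rpow_mul_natCast (by norm_num), ← Real.rpow_mul_natCast (by norm_num)]
    norm_num
  have hs : σ ^ 2 = σ ^ (5 / 4 : ℝ) * σ ^ (3 / 4 : ℝ) := by
    rw [← Real.rpow_add hσ, ← Real.rpow_natCast]
    norm_num
  have hnn : n = n ^ (3 / 8 : ℝ) * n ^ (5 / 8 : ℝ) := by
    rw [← Real.rpow_add hn0]
    norm_num
  have e : σ ^ 2 * idealSize σ n V / n = (2 : ℝ) ^ (5 / 4 : ℝ) * 3 ^ (3 / 4 : ℝ) *
      (σ ^ (5 / 4 : ℝ) * V ^ (3 / 4 : ℝ) * Real.log (2 * n) ^ (3 / 8 : ℝ) / n ^ (5 / 8 : ℝ)) := by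
    unfold idealSize
    set L := Real.log (2 * n)
    rw [hs]
    nth_rw 2 [hnn]
    have : 0 < σ ^ (3 / 4 : ℝ) := by positivity
    have : 0 < n ^ (3 / 8 : ℝ) := by positivity
    have : 0 < n ^ (5 / 8 : ℝ) := by positivity
    field_simp
  rw [e]
  exact mul_le_mul_of_nonneg_right hκ (by positivity)

theorem idealTuning_le {σ n V : ℝ} (hσ : 0 < σ) (hn : 1 ≤ n) (hV : 0 < V) :
    idealTuning σ n V ≤
      2.152 * (σ ^ (5 / 4 : ℝ) * Real.log (2 * n) ^ (3 / 8 : ℝ)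
        / (n ^ (5 / 8 : ℝ) * V ^ (1 / 4 : ℝ))) := by
  have hn0 : 0 < n := by linarith
  have hL : 0 < Real.log (2 * n) := Real.log_pos (by linarith)
  have hκ : (3 : ℝ) ^ (3 / 4 : ℝ) / 2 ^ (1 / 12 : ℝ) ≤ 2.152 := by
    refine le_of_pow_le_pow_left₀ (n := 12) (by norm_num) (by norm_num) ?_
    rw [div_pow, ← Real.rpow_mul_natCast (by norm_num), ← Real.rpow_mul_natCast (by norm_num)]
    norm_num
  have e : idealTuning σ n V = (3 : ℝ) ^ (3 / 4 : ℝ) / 2 ^ (1 / 12 : ℝ) *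
      (σ ^ (5 / 4 : ℝ) * Real.log (2 * n) ^ (3 / 8 : ℝ)
        / (n ^ (5 / 8 : ℝ) * V ^ (1 / 4 : ℝ))) := by
    unfold idealTuning
    ring
  rw [e]
  exact mul_le_mul_of_nonneg_right hκ (by positivity)

/-- Putting the noise level in place of the total variation makes the choice independent of the
image. -/
theorem idealSize_self {σ : ℝ} (hσ : 0 < σ) (n : ℝ) : idealSize σ n σ =
    2 ^ (5 / 4 : ℝ) * 3 ^ (3 / 4 : ℝ) * Real.log (2 * n) ^ (3 / 8 : ℝ) * n ^ (3 / 8 : ℝ) := by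
  have : σ ^ (3 / 4 : ℝ) ≠ 0 := by positivity
  rw [idealSize, mul_div_cancel_right₀ _ this]

theorem rpow_div_rpow_quarter {x : ℝ} (hx : 0 < x) (a b : ℝ) (h : a = b + 1 / 4) :
    x ^ a / x ^ (1 / 4 : ℝ) = x ^ b := by
  rw [← Real.rpow_sub hx, h, add_sub_cancel_right]

theorem idealTuning_self {σ : ℝ} (hσ : 0 < σ) (n : ℝ) : idealTuning σ n σ =
    3 ^ (3 / 4 : ℝ) * σ * Real.log (2 * n) ^ (3 / 8 : ℝ)
      / (2 ^ (1 / 12 : ℝ) * n ^ (5 / 8 : ℝ)) := by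
  have h := rpow_div_rpow_quarter hσ (5 / 4) 1 (by norm_num)
  rw [Real.rpow_one] at h
  rw [idealTuning]
  nth_rw 3 [← h]
  ring

/-- The bound on the antiprojections, the admissibility of the tuning parameter and the error
bound for a mesh grid adapted to the total variation `V`, which need not be that of the image. -/
theorem meshGrid_conclusions {Ω : Type*} [MeasurableSpace Ω] {P : Measure Ω} {t : ℕ}
    (h₁ : 0 < n₁) (ht : 0 < t) (hteven : Even t) (hdvd : t ^ 2 + 1 ∣ n₁) {σ : ℝ} (hσ : 0 < σ)
    (f₀ : Image n₁ n₁) {ε : Ω → Image n₁ n₁}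
    (hε_law : ∀ p, HasLaw (fun ω => ε ω p) (gaussianReal 0 (σ ^ 2).toNNReal) P)
    (hε_indep : iIndepFun (fun p ω => ε ω p) P) {V n b : ℝ} (hV : 0 < V)
    (hn : n = (n₁ : ℝ) * n₁) (hX : idealSize σ n V ≤ meshSize t t)
    (hb : 4 * idealTuning σ n V * TV f₀ + 2 * σ ^ 2 * meshSize t t / n
      + 4 * σ ^ 2 * Real.log (2 * n) / n ≤ b) :
    IsAntiprojectionBound (meshGrid n₁ n₁ t t) (fun _ => 3 / (2 * (t : ℝ))) ∧
    inverseScaling (meshGrid n₁ n₁ t t) (fun _ => 3 / (2 * (t : ℝ))) *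
      lambda0 σ n (Real.log (2 * n)) ≤ idealTuning σ n V ∧
    1 - 1 / n ≤ P.real {ω | ‖interactionEstimator (idealTuning σ n V) (f₀ + ε ω)
      - interaction f₀‖ ^ 2 / n ≤ b} := by
  have hn1 : 1 ≤ n := by
    rw [hn]
    exact_mod_cast Nat.mul_pos h₁ h₁
  have hP : IsProbabilityMeasure P := hε_indep.isProbabilityMeasure
  have hv := isAntiprojectionBound_meshGrid h₁ ht hteven hdvd
  have hs : (meshSize t t : ℝ) = 2 * (t : ℝ) ^ 3 := by
    rw [meshSize]
    push_cast
    ring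
  have hl := lambda0_le_idealTuning hσ hn1 hV (by exact_mod_cast ht) (hX.trans_eq hs)
  refine ⟨hv, le_trans ?_ hl, ?_⟩
  · refine mul_le_mul_of_nonneg_right (inverseScaling_le _ (by positivity)) ?_
    unfold lambda0
    positivity
  · refine (one_sub_inv_le_measureReal_mse_le h₁ h₁ hσ f₀ hε_law hε_indep (by positivity) hv
      (Nat.cast_le.2 (finrank_activeSpan_meshGrid_le n₁ t)) hn hl).trans
      (measureReal_mono fun ω hω => le_trans hω hb)

end TVDenoise

end

/-- Slow rates for total variation denoising of a square image. -/
theorem mainTheorem3 {Ω : Type*} [MeasurableSpace Ω] (P : Measure Ω) [IsProbabilityMeasure P]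
    (n₁ t : ℕ) (hn₁ : 0 < n₁) (ht : 0 < t) (hteven : Even t) (hdvd : t ^ 2 + 1 ∣ n₁)
    (σ : ℝ) (hσ : 0 < σ) (C : ℝ) (hC : 0 < C)
    (f₀ : TVDenoise.Image n₁ n₁)
    (hf₀ : TVDenoise.interaction f₀ ∈ TVDenoise.tvClass n₁ n₁ C)
    (ε : Ω → TVDenoise.Image n₁ n₁)
    (hε_law : ∀ p, HasLaw (fun ω => ε ω p) (gaussianReal 0 (σ ^ 2).toNNReal) P)
    (hε_indep : iIndepFun (fun p ω => ε ω p) P) :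
    let n : ℝ := (n₁ : ℝ) * n₁
    let L : ℝ := Real.log (2 * n)
    let V : ℝ := TVDenoise.TV f₀
    let S : Set (TVDenoise.DIdx n₁ n₁) := TVDenoise.meshGrid n₁ n₁ t t
    let s : ℕ := TVDenoise.meshSize t t
    let v : TVDenoise.DIdx n₁ n₁ → ℝ := fun _ => 3 / (2 * (t : ℝ))
    let mse : ℝ → Ω → ℝ := fun lam ω =>
      ‖TVDenoise.interactionEstimator lam (f₀ + ε ω) - TVDenoise.interaction f₀‖ ^ 2 / n
    -- the active set and the tuning parameter may depend on the image
    (let X : ℝ := 2 ^ (5 / 4 : ℝ) * 3 ^ (3 / 4 : ℝ) * L ^ (3 / 8 : ℝ) * n ^ (3 / 8 : ℝ)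
        * V ^ (3 / 4 : ℝ) / σ ^ (3 / 4 : ℝ)
      let lam : ℝ := 3 ^ (3 / 4 : ℝ) * σ ^ (5 / 4 : ℝ) * L ^ (3 / 8 : ℝ)
        / (2 ^ (1 / 12 : ℝ) * n ^ (5 / 8 : ℝ) * V ^ (1 / 4 : ℝ))
      0 < V → ⌈X⌉₊ ≤ s → (s : ℝ) ≤ 7 / 5 * X + 1 →
        TVDenoise.IsAntiprojectionBound S v ∧
        TVDenoise.inverseScaling S v * TVDenoise.lambda0 σ n L ≤ lam ∧
        1 - 1 / n ≤ P.real {ω | mse lam ω ≤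
          24 * σ ^ (5 / 4 : ℝ) * C ^ (3 / 4 : ℝ) * L ^ (3 / 8 : ℝ) / n ^ (5 / 8 : ℝ)
            + 4 * σ ^ 2 * L / n + 2 * σ ^ 2 / n}) ∧
    -- the active set and the tuning parameter do not depend on the image
    (let X : ℝ := 2 ^ (5 / 4 : ℝ) * 3 ^ (3 / 4 : ℝ) * L ^ (3 / 8 : ℝ) * n ^ (3 / 8 : ℝ)
      let lam : ℝ := 3 ^ (3 / 4 : ℝ) * σ * L ^ (3 / 8 : ℝ)
        / (2 ^ (1 / 12 : ℝ) * n ^ (5 / 8 : ℝ))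
      ⌈X⌉₊ ≤ s → (s : ℝ) ≤ 11 / 10 * X + 1 →
        TVDenoise.IsAntiprojectionBound S v ∧
        TVDenoise.inverseScaling S v * TVDenoise.lambda0 σ n L ≤ lam ∧
        1 - 1 / n ≤ P.real {ω | mse lam ω ≤
          12 * σ * (C + σ) * L ^ (3 / 8 : ℝ) / n ^ (5 / 8 : ℝ)
            + 4 * σ ^ 2 * L / n + 2 * σ ^ 2 / n}) := by
  intro n L V S s v mse
  have hn1 : 1 ≤ n := by
    simp only [n]
    exact_mod_cast Nat.mul_pos hn₁ hn₁
  have hn0 : 0 < n := by linarith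
  have hL : 0 < L := Real.log_pos (by linarith)
  have hVC : V ≤ C := by
    have h : TVDenoise.TV (TVDenoise.interaction f₀) ≤ C := hf₀
    rwa [TVDenoise.TV_interaction] at h
  refine ⟨?_, ?_⟩
  · intro X lam hV hXs hsX
    refine TVDenoise.meshGrid_conclusions hn₁ ht hteven hdvd hσ f₀ hε_law hε_indep hV rfl
      (Nat.ceil_le.1 hXs) ?_
    have h1 := TVDenoise.idealSize_mul_le hσ hn1 hV
    have h2 := mul_le_mul_of_nonneg_right (TVDenoise.idealTuning_le hσ hn1 hV) hV.le
    change σ ^ 2 * X / n ≤ 5.422 * (σ ^ (5 / 4 : ℝ) * V ^ (3 / 4 : ℝ) * L ^ (3 / 8 : ℝ)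
        / n ^ (5 / 8 : ℝ)) at h1
    change lam * V ≤ _ * (_ * L ^ (3 / 8 : ℝ) / _) * V at h2
    change 4 * lam * V + 2 * σ ^ 2 * s / n + 4 * σ ^ 2 * L / n ≤ _
    have h3 := TVDenoise.rpow_div_rpow_quarter hV 1 (3 / 4) (by norm_num)
    rw [Real.rpow_one] at h3
    have h4 : 2.152 * (σ ^ (5 / 4 : ℝ) * L ^ (3 / 8 : ℝ) / (n ^ (5 / 8 : ℝ) * V ^ (1 / 4 : ℝ))) * V
        = 2.152 * (σ ^ (5 / 4 : ℝ) * V ^ (3 / 4 : ℝ) * L ^ (3 / 8 : ℝ) / n ^ (5 / 8 : ℝ)) := by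
      rw [← h3]
      ring
    rw [h4] at h2
    have h5 : 2 * σ ^ 2 * s / n ≤ 14 / 5 * (σ ^ 2 * X / n) + 2 * σ ^ 2 / n := by
      calc 2 * σ ^ 2 * s / n ≤ 2 * σ ^ 2 * (7 / 5 * X + 1) / n := by gcongr
        _ = _ := by ring
    have h6 : σ ^ (5 / 4 : ℝ) * V ^ (3 / 4 : ℝ) * L ^ (3 / 8 : ℝ) / n ^ (5 / 8 : ℝ) ≤
        σ ^ (5 / 4 : ℝ) * C ^ (3 / 4 : ℝ) * L ^ (3 / 8 : ℝ) / n ^ (5 / 8 : ℝ) := by gcongr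
    have h7 : 24 * σ ^ (5 / 4 : ℝ) * C ^ (3 / 4 : ℝ) * L ^ (3 / 8 : ℝ) / n ^ (5 / 8 : ℝ) =
        24 * (σ ^ (5 / 4 : ℝ) * C ^ (3 / 4 : ℝ) * L ^ (3 / 8 : ℝ) / n ^ (5 / 8 : ℝ)) := by ring
    have h8 : 0 ≤ σ ^ (5 / 4 : ℝ) * V ^ (3 / 4 : ℝ) * L ^ (3 / 8 : ℝ) / n ^ (5 / 8 : ℝ) := by
      positivity
    rw [h7]
    -- The constants add up to 4 · 2.152 + (14/5) · 5.422 < 24.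
    linarith
  · intro X lam hXs hsX
    have eX : TVDenoise.idealSize σ n σ = X := TVDenoise.idealSize_self hσ n
    have el : TVDenoise.idealTuning σ n σ = lam := TVDenoise.idealTuning_self hσ n
    have h1 := TVDenoise.idealSize_mul_le hσ hn1 hσ
    have h2 := TVDenoise.idealTuning_le hσ hn1 hσ
    have key := TVDenoise.meshGrid_conclusions (P := P) (V := σ) (n := n)
      (b := 12 * σ * (C + σ) * L ^ (3 / 8 : ℝ) / n ^ (5 / 8 : ℝ)
            + 4 * σ ^ 2 * L / n + 2 * σ ^ 2 / n) hn₁ ht hteven hdvd hσ f₀ hε_law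
      hε_indep hσ rfl (by rw [eX]; exact Nat.ceil_le.1 hXs)
    rw [el] at key h2
    rw [eX] at h1
    refine key ?_
    change σ ^ 2 * X / n ≤ 5.422 * (_ * L ^ (3 / 8 : ℝ) / n ^ (5 / 8 : ℝ)) at h1
    change lam ≤ 2.152 * (_ * L ^ (3 / 8 : ℝ) / _) at h2
    change 4 * lam * V + 2 * σ ^ 2 * s / n + 4 * σ ^ 2 * L / n ≤ _
    have h3 := TVDenoise.rpow_div_rpow_quarter hσ (5 / 4) 1 (by norm_num)
    rw [Real.rpow_one] at h3
    have h3' : σ ^ (5 / 4 : ℝ) * σ ^ (3 / 4 : ℝ) = σ * σ := by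
      rw [← Real.rpow_add hσ, ← sq, ← Real.rpow_natCast]
      norm_num
    set R := L ^ (3 / 8 : ℝ) / n ^ (5 / 8 : ℝ) with hR
    have hR0 : 0 ≤ R := by positivity
    have h4 : σ ^ (5 / 4 : ℝ) * L ^ (3 / 8 : ℝ) / (n ^ (5 / 8 : ℝ) * σ ^ (1 / 4 : ℝ)) = σ * R := by
      rw [hR]
      nth_rw 3 [← h3]
      ring
    rw [h4] at h2
    rw [h3', mul_div_assoc (σ * σ), ← hR] at h1
    have hV0 : 0 ≤ V := TVDenoise.TV_nonneg f₀
    have h5 : 2 * σ ^ 2 * s / n ≤ 11 / 5 * (σ ^ 2 * X / n) + 2 * σ ^ 2 / n := by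
      calc 2 * σ ^ 2 * s / n ≤ 2 * σ ^ 2 * (11 / 10 * X + 1) / n := by gcongr
        _ = _ := by ring
    have h6 : lam * V ≤ 2.152 * (σ * R) * C := by gcongr
    have h7 : 12 * σ * (C + σ) * L ^ (3 / 8 : ℝ) / n ^ (5 / 8 : ℝ)
        = 12 * (σ * R * C) + 12 * (σ * σ * R) := by
      rw [hR]
      ring
    have h8 : 0 ≤ σ * R * C := by positivity
    have h9 : 0 ≤ σ * σ * R := by positivity
    rw [h7]
    -- Here 4 · 2.152 < 12 for the term in C, and (11/5) · 5.422 < 12 for the term in σ.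
    linarith
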